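/- **Theorem 1 (the Normex approximation).** Let $0<\alpha\le 4$ and $k=k(\alpha)=[4/\alpha-1]+1$ ($[\cdot]$ the integer part). For each $n$ let $X_1,\dots,X_n$ be iid Pareto random variables, $\mathbb P(X_i>x)=x^{-\alpha}$ for $x\ge1$, with order statistics $X_{(1)}\le\cdots\le X_{(n)}$ and sum $S_n$. For $n>k$ write $$S_n=T_k+X_{(n-k+1)}+U_{n-k+1},\qquad T_k=\sum_{j=1}^{n-k}X_{(j)},\quad U_{n-k+1}=\sum_{j=n-k+2}^{n}X_{(j)} .$$ For $y>1$ let $$f_{(i)}(y)=\frac{n!}{(i-1)!\,(n-i)!}\,\alpha\,(1-y^{-\alpha})^{i-1}y^{-\alpha(n-i+1)-1},\qquad h_y(u)=\frac{\alpha y^{\alpha}}{u^{\alpha+1}}\mathbf 1_{(u\ge y)},$$ $$m_1(y)=\frac{n-k}{1-y^{-\alpha}}\times\begin{cases}\dfrac{1-y^{1-\alpha}}{1-1/\alpha}&\alpha\ne1\\[2mm] \ln y&\alpha=1\end{cases}$$ $$\sigma^2(y)=\begin{cases}(n-k)\,y\left(1-\dfrac{y\ln^2y}{(y-1)^2}\right)&\alpha=1\\[2mm]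 2(n-k)\dfrac{y^2}{y^2-1}\left(\ln y-2\,\dfrac{y-1}{y+1}\right)&\alpha=2\\[2mm] \dfrac{n-k}{1-y^{-\alpha}}\left(\dfrac{1-y^{2-\alpha}}{1-2/\alpha}-\dfrac{1}{(1-1/\alpha)^2}\,\dfrac{(1-y^{1-\alpha})^2}{1-y^{-\alpha}}\right)&\alpha\ne1,2\end{cases}$$ and, $\varphi$ being the standard normal density, $\varphi_{m,s^2}$ the density of $N(m,s^2)$ and $h_y^{(k-1)*}$ the $(k-1)$-fold convolution of $h_y$, let for $x\ge1$ $$G_{n,\alpha,k}(x)=\begin{cases}\displaystyle n\alpha\int_1^x\frac{1}{\sigma(y)}\,\frac{(1-y^{-\alpha})^{n-1}}{y^{1+\alpha}}\int_0^{x-y}\varphi\!\left(\frac{v-m_1(y)}{\sigma(y)}\right)dv\,dy& k=1\\[4mm] \displaystyle\int_1^x f_{(n-k+1)}(y)\int_0^{x-y}\big(\varphi_{m_1(y),\sigma^2(y)}*h_y^{(k-1)*}\big)(v)\,dv\,dy& k\ge2.\end{cases}$$ Then $G_{n,\alpha,k}$ approximates the cdf of $S_n$ in the following sense. 1. For every $n>k$: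 $X_{(n-k+1)}$ has density $f_{(n-k+1)}$ on $(1,\infty)$. For almost every $y>1$, given $X_{(n-k+1)}=y$, the sums $T_k$ and $U_{n-k+1}$ are independent, $T_k$ has mean $m_1(y)$ and variance $\sigma^2(y)>0$ (with finite second moment), and, if $k\ge2$, $U_{n-k+1}$ has density $h_y^{(k-1)*}$. 2. For every $n>k$ and $x\ge1$, $$\big|\mathbb P(S_n\le x)-G_{n,\alpha,k}(x)\big|\le 2\int_1^x f_{(n-k+1)}(y)\,\Delta_n(y)\,dy,$$ where $\Delta_n(y)=\sup_{t\in\mathbb R}\big|\mathbb P(T_k\le t\mid X_{(n-k+1)}=y)-\Phi_{m_1(y),\sigma^2(y)}(t)\big|$ and $\Phi_{m,s^2}$ is the cdf of $N(m,s^2)$. 3. For almost every $y>1$, as $n\to\infty$, $\Delta_n(y)\to0$; and $\mathbb P(S_n\le x\mid X_{(n-k+1)}=y)$ minus the inner part of $G_{n,\alpha,k}(x)$ at $y$ (that is, $\frac1{\sigma(y)}\int_0^{x-y}\varphi\big(\frac{v-m_1(y)}{\sigma(y)}\big)dv$ if $k=1$, and $\int_0^{x-y}\big(\varphi_{m_1(y),\sigma^2(y)}*h_y^{(k-1)*}\big)(v)\,dv$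 if $k\ge2$) tends to $0$ uniformly in $x\ge y$. 4. If $\alpha\ge2$, then $\sup_{x\ge1}\big|\mathbb P(S_n\le x)-G_{n,\alpha,k}(x)\big|\to0$ as $n\to\infty$. -/

import Mathlib

open MeasureTheory ProbabilityTheory Filter Topology Set

noncomputable section

namespace Normex

/-- `orderStat x i` is the `i`-th smallest entry `x_{(i)}` of the sample `x`, for `1 ≤ i ≤ n`
(and `0` for other `i`). -/
def orderStat {n : ℕ} (x : Fin n → ℝ) (i : ℕ) : ℝ :=
  if h : 1 ≤ i ∧ i ≤ n then x (Tuple.sort x ⟨i - 1, by omega⟩) else 0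

/-- The trimmed sum `T_k = x_{(1)} + ⋯ + x_{(n-k)}`. -/
def trimmedSum {n : ℕ} (x : Fin n → ℝ) (k : ℕ) : ℝ :=
  ∑ j ∈ Finset.Icc 1 (n - k), orderStat x j

/-- The order statistic `x_{(n-k+1)}`, the `k`-th largest entry. -/
def pivot {n : ℕ} (x : Fin n → ℝ) (k : ℕ) : ℝ :=
  orderStat x (n - k + 1)

/-- The sum `U_{n-k+1} = x_{(n-k+2)} + ⋯ + x_{(n)}` of the `k - 1` largest entries. -/
def topSum {n : ℕ} (x : Fin n → ℝ) (k : ℕ) : ℝ :=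
  ∑ j ∈ Finset.Icc (n - k + 2) n, orderStat x j

/-- The threshold `k(α) = [4/α - 1] + 1` (used for `0 < α ≤ 4`). -/
def threshold (α : ℝ) : ℕ := ⌊4 / α - 1⌋₊ + 1

/-- The density of the `i`-th order statistic of an `n`-sample of the Pareto law with shape
`α` on `[1, ∞)`, at `x ≥ 1`. -/
def orderStatPDF (n i : ℕ) (α x : ℝ) : ℝ :=
  (n.factorial : ℝ) / (((i - 1).factorial : ℝ) * ((n - i).factorial : ℝ)) *
    α * (1 - x ^ (-α)) ^ (i - 1) * x ^ (-α * ((n : ℝ) - i + 1) - 1)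

/-- The mean `m₁(α, n, k, y)`. -/
def condMean (n k : ℕ) (α y : ℝ) : ℝ :=
  ((n : ℝ) - k) / (1 - y ^ (-α)) *
    (if α = 1 then Real.log y else (1 - y ^ (1 - α)) / (1 - 1 / α))

/-- The variance `σ²(α, n, k, y)`. -/
def condVar (n k : ℕ) (α y : ℝ) : ℝ :=
  if α = 1 then
    ((n : ℝ) - k) * y * (1 - y * Real.log y ^ 2 / (y - 1) ^ 2)
  else if α = 2 then
    2 * ((n : ℝ) - k) * (y ^ 2 / (y ^ 2 - 1)) * (Real.log y - 2 * ((y - 1) / (y + 1)))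
  else
    ((n : ℝ) - k) / (1 - y ^ (-α)) *
      ((1 - y ^ (2 - α)) / (1 - 2 / α) -
        1 / (1 - 1 / α) ^ 2 * ((1 - y ^ (1 - α)) ^ 2 / (1 - y ^ (-α))))

/-- The standard deviation `σ(y)`. -/
def condStd (n k : ℕ) (α y : ℝ) : ℝ := √(condVar n k α y)

/-- The normal law `N(m₁(y), σ²(y))`. -/
def condNormal (n k : ℕ) (α y : ℝ) : Measure ℝ :=
  gaussianReal (condMean n k α y) (condVar n k α y).toNNReal

/-- The convolution `(f ∗ g)(v) = ∫ f(u) g(v - u) du` of real functions on the line. -/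
def conv (f g : ℝ → ℝ) : ℝ → ℝ :=
  convolution f g (ContinuousLinearMap.mul ℝ ℝ) volume

/-- The `m`-fold convolution `f ∗ ⋯ ∗ f`, for `m ≥ 1` (the value at `m = 0` is not used). -/
def convPow (f : ℝ → ℝ) : ℕ → ℝ → ℝ
  | 0 => 0
  | 1 => f
  | m + 2 => conv (convPow f (m + 1)) f

/-- The density `h_y(x) = α y^α / x^(α+1)` for `x ≥ y` (and `0` for `x < y`) of the Pareto law
with parameters `α` and `y`. -/
def upperPDF (α y : ℝ) : ℝ → ℝ := paretoPDFReal y α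

/-- The inner integral of the mixture, at `s = x - y`. -/
def normexInner (n k : ℕ) (α y s : ℝ) : ℝ :=
  if k = 1 then
    1 / condStd n k α y *
      ∫ v in (0 : ℝ)..s, gaussianPDFReal 0 1 ((v - condMean n k α y) / condStd n k α y)
  else
    ∫ v in (0 : ℝ)..s,
      conv (gaussianPDFReal (condMean n k α y) (condVar n k α y).toNNReal)
        (convPow (upperPDF α y) (k - 1)) v

/-- The Normex mixture `G_{n,α,k}(x)`. -/
def normexCDF (n k : ℕ) (α x : ℝ) : ℝ :=
  if k = 1 then
    n * α * ∫ y in (1 : ℝ)..x,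
      (1 - y ^ (-α)) ^ (n - 1) / y ^ (1 + α) * normexInner n k α y (x - y)
  else
    ∫ y in (1 : ℝ)..x, orderStatPDF n (n - k + 1) α y * normexInner n k α y (x - y)

/-- The uniform (Kolmogorov) distance between the cdfs of two laws on the line. -/
def kolmogorovDist (μ ν : Measure ℝ) : ℝ := ⨆ t : ℝ, |cdf μ t - cdf ν t|

end Normex

end

/-!
Given the pivot `y`, the `n - k` smaller observations are independent with the Pareto law
conditioned to `Iio y`, and the `k - 1` larger ones are independent Pareto variables starting at
`y`. So the sum splits, conditionally, into `y` and two independent sums, and replacing the first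
of them by the normal law with the same mean and variance costs at most the Kolmogorov distance
`Δ_n(y)` at each of the two ends of the interval `(0, x - y]`. Integrating against the law of the
pivot gives the error bound.

For fixed `y` the conditioned observations are bounded, and the central limit theorem applies. For
the unconditional statement it has to hold uniformly over the pivots. It does over all centred laws
whose bound is small compared to the standard deviation of the sum: otherwise some triangular array
of such laws would violate it, but the characteristic functions of the normalized row sums converge
to the Gaussian one. When `α ≥ 2` the pivot falls in this range with probability tending to one: it
is of order `n ^ (1 / α)`, while the standard deviation is of order `√n` if `α > 2` and of order
larger than `√n` if `α = 2`.
-/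

noncomputable section

namespace Normex

/-! ### The Kolmogorov distance -/

lemma abs_cdf_sub_cdf_le_one (μ ν : Measure ℝ) (t : ℝ) : |cdf μ t - cdf ν t| ≤ 1 :=
  abs_sub_le_iff.2 ⟨by linarith [cdf_le_one μ t, cdf_nonneg ν t],
    by linarith [cdf_le_one ν t, cdf_nonneg μ t]⟩

lemma abs_cdf_sub_cdf_le_kolmogorovDist (μ ν : Measure ℝ) (t : ℝ) :
    |cdf μ t - cdf ν t| ≤ kolmogorovDist μ ν :=
  le_ciSup ⟨1, forall_mem_range.2 (abs_cdf_sub_cdf_le_one μ ν)⟩ t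

lemma kolmogorovDist_nonneg (μ ν : Measure ℝ) : 0 ≤ kolmogorovDist μ ν :=
  Real.iSup_nonneg fun _ => abs_nonneg _

lemma kolmogorovDist_le_one (μ ν : Measure ℝ) : kolmogorovDist μ ν ≤ 1 :=
  ciSup_le (abs_cdf_sub_cdf_le_one μ ν)

lemma cdf_map_mul_add {μ : Measure ℝ} [IsProbabilityMeasure μ] {a : ℝ} (ha : 0 < a) (b t : ℝ) :
    cdf (μ.map fun x => a * x + b) t = cdf μ ((t - b) / a) := by
  have : IsProbabilityMeasure (μ.map fun x => a * x + b) :=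
    Measure.isProbabilityMeasure_map (by fun_prop)
  rw [cdf_eq_real, cdf_eq_real, map_measureReal_apply (by fun_prop) measurableSet_Iic]
  congr 1 with x
  simp only [mem_preimage, mem_Iic, le_div_iff₀ ha, le_sub_iff_add_le, mul_comm a]

lemma kolmogorovDist_map_mul_add {μ ν : Measure ℝ} [IsProbabilityMeasure μ]
    [IsProbabilityMeasure ν] {a : ℝ} (ha : 0 < a) (b : ℝ) :
    kolmogorovDist (μ.map fun x => a * x + b) (ν.map fun x => a * x + b) =
      kolmogorovDist μ ν := by
  have hsurj : Function.Surjective fun t : ℝ => (t - b) / a := fun s =>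
    ⟨a * s + b, by field_simp; ring⟩
  simp only [kolmogorovDist, cdf_map_mul_add ha]
  exact hsurj.iSup_comp fun t => |cdf μ t - cdf ν t|

lemma continuous_cdf {μ : Measure ℝ} [IsProbabilityMeasure μ] [NullSingletonClass μ] :
    Continuous (cdf μ) := by
  refine continuous_iff_continuousAt.2 fun x => ?_
  have hjump := (cdf μ).measure_singleton x
  rw [measure_cdf, measure_singleton, eq_comm, ENNReal.ofReal_eq_zero, sub_nonpos] at hjump
  rw [(monotone_cdf μ).continuousAt_iff_leftLim_eq_rightLim, (cdf μ).rightLim_eq]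
  exact le_antisymm ((monotone_cdf μ).leftLim_le le_rfl) hjump

lemma tendstoLocallyUniformly_of_monotone {ι : Type*} {l : Filter ι} {F : ι → ℝ → ℝ} {G : ℝ → ℝ}
    (hF : ∀ i, Monotone (F i)) (hG : Monotone G) (hGc : Continuous G)
    (h : ∀ t, Tendsto (fun i => F i t) l (𝓝 (G t))) : TendstoLocallyUniformly F G l := by
  refine Metric.tendstoLocallyUniformly_iff.2 fun ε hε x => ?_
  have hnear : ∀ᶠ y in 𝓝 x, |G y - G x| < ε / 4 :=
    hGc.continuousAt.eventually (Metric.ball_mem_nhds (G x) (by positivity))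
  obtain ⟨a, b, hx, hab⟩ := mem_nhds_iff_exists_Ioo_subset.1
    (show {y | |G y - G x| < ε / 4} ∈ 𝓝 x from hnear)
  obtain ⟨u, hau, hux⟩ := exists_between hx.1
  obtain ⟨v, hxv, hvb⟩ := exists_between hx.2
  have hu : |G u - G x| < ε / 4 := hab ⟨hau, hux.trans hx.2⟩
  have hv : |G v - G x| < ε / 4 := hab ⟨hx.1.trans hxv, hvb⟩
  refine ⟨Ioo u v, Ioo_mem_nhds hux hxv, ?_⟩
  filter_upwards [(h u).eventually (Metric.ball_mem_nhds _ (by positivity : 0 < ε / 2)),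
    (h v).eventually (Metric.ball_mem_nhds _ (by positivity : 0 < ε / 2))] with i hiu hiv y hy
  rw [Real.dist_eq, abs_lt] at hiu hiv
  rw [abs_lt] at hu hv
  rw [Real.dist_eq, abs_lt]
  constructor <;>
    linarith [hF i hy.1.le, hF i hy.2.le, hG hy.1.le, hG hy.2.le]

lemma tendstoUniformly_cdf {ι : Type*} {l : Filter ι} {μ : ι → Measure ℝ} {ν : Measure ℝ}
    [IsProbabilityMeasure ν] [NullSingletonClass ν]
    (h : ∀ t, Tendsto (fun i => cdf (μ i) t) l (𝓝 (cdf ν t))) :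
    TendstoUniformly (fun i => cdf (μ i)) (cdf ν) l := by
  refine Metric.tendstoUniformly_iff.2 fun ε hε => ?_
  obtain ⟨a, ha⟩ := ((tendsto_cdf_atBot ν).eventually (gt_mem_nhds (half_pos hε))).exists
  obtain ⟨b, hb⟩ := ((tendsto_cdf_atTop ν).eventually
    (lt_mem_nhds (by linarith : 1 - ε / 2 < 1))).exists
  have hcompact : TendstoUniformlyOn (fun i => cdf (μ i)) (cdf ν) l (Icc a b) :=
    (tendstoLocallyUniformlyOn_iff_tendstoUniformlyOn_of_compact isCompact_Icc).1
      (tendstoLocallyUniformly_of_monotone (fun i => monotone_cdf (μ i)) (monotone_cdf ν)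
        continuous_cdf h).tendstoLocallyUniformlyOn
  filter_upwards [Metric.tendstoUniformlyOn_iff.1 hcompact ε hε,
    (h a).eventually (gt_mem_nhds (show cdf ν a < ε by linarith)),
    (h b).eventually (lt_mem_nhds (show 1 - ε < cdf ν b by linarith))] with i hi hia hib t
  rcases lt_or_ge t a with hta | hta
  · rw [Real.dist_eq, abs_lt]
    constructor <;> linarith [monotone_cdf ν hta.le, monotone_cdf (μ i) hta.le,
      cdf_nonneg ν t, cdf_nonneg (μ i) t]
  · rcases lt_or_ge b t with hbt | htb
    · rw [Real.dist_eq, abs_lt]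
      constructor <;> linarith [monotone_cdf ν hbt.le, monotone_cdf (μ i) hbt.le,
        cdf_le_one ν t, cdf_le_one (μ i) t]
    · exact hi t ⟨hta, htb⟩

lemma tendsto_kolmogorovDist_of_tendsto_cdf {ι : Type*} {l : Filter ι} {μ : ι → Measure ℝ}
    {ν : Measure ℝ} [IsProbabilityMeasure ν] [NullSingletonClass ν]
    (h : ∀ t, Tendsto (fun i => cdf (μ i) t) l (𝓝 (cdf ν t))) :
    Tendsto (fun i => kolmogorovDist (μ i) ν) l (𝓝 0) := by
  refine Metric.tendsto_nhds.2 fun ε hε => ?_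
  filter_upwards [Metric.tendstoUniformly_iff.1 (tendstoUniformly_cdf h) _ (half_pos hε)] with i hi
  rw [Real.dist_eq, sub_zero, abs_of_nonneg (kolmogorovDist_nonneg _ _)]
  refine (ciSup_le fun t => ?_ : _ ≤ ε / 2).trans_lt (half_lt_self hε)
  rw [abs_sub_comm]
  exact (hi t).le

lemma tendsto_kolmogorovDist_of_tendsto_charFun {μ : ℕ → Measure ℝ} {ν : Measure ℝ}
    [∀ n, IsProbabilityMeasure (μ n)] [IsProbabilityMeasure ν] [NullSingletonClass ν]
    (h : ∀ t, Tendsto (fun n => charFun (μ n) t) atTop (𝓝 (charFun ν t))) :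
    Tendsto (fun n => kolmogorovDist (μ n) ν) atTop (𝓝 0) := by
  let μ' : ℕ → ProbabilityMeasure ℝ := fun n => ⟨μ n, inferInstance⟩
  let ν' : ProbabilityMeasure ℝ := ⟨ν, inferInstance⟩
  have hweak : Tendsto μ' atTop (𝓝 ν') := ProbabilityMeasure.tendsto_iff_tendsto_charFun.2 h
  refine tendsto_kolmogorovDist_of_tendsto_cdf fun t => ?_
  simp only [cdf_eq_real]
  exact (ENNReal.tendsto_toReal (measure_ne_top _ _)).comp
    (ProbabilityMeasure.tendsto_measure_of_null_frontier_of_tendsto' hweak (E := Iic t)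
      (by simp [ν']))

/-! ### A central limit theorem uniform over bounded laws -/

lemma norm_pow_sub_pow_le_nat_mul {R : Type*} [SeminormedCommRing R] [NormOneClass R] {a b : R}
    (ha : ‖a‖ ≤ 1) (hb : ‖b‖ ≤ 1) (N : ℕ) : ‖a ^ N - b ^ N‖ ≤ N * ‖a - b‖ := by
  induction N with
  | zero => simp
  | succ N ih =>
    calc ‖a ^ (N + 1) - b ^ (N + 1)‖ = ‖a ^ N * (a - b) + (a ^ N - b ^ N) * b‖ := by ring_nf
      _ ≤ ‖a ^ N‖ * ‖a - b‖ + ‖a ^ N - b ^ N‖ * ‖b‖ :=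
        (norm_add_le _ _).trans (add_le_add (norm_mul_le _ _) (norm_mul_le _ _))
      _ ≤ 1 * ‖a - b‖ + (N * ‖a - b‖) * 1 := by
        gcongr
        exact (norm_pow_le a N).trans (pow_le_one₀ (norm_nonneg _) ha)
      _ = (N + 1 : ℕ) * ‖a - b‖ := by push_cast; ring

lemma norm_exp_mul_I_sub_quadratic_le {x : ℝ} (hx : |x| ≤ 1) :
    ‖Complex.exp (x * Complex.I) - (1 + x * Complex.I - x ^ 2 / 2)‖ ≤ |x| ^ 3 := by
  have hnorm : ‖(x * Complex.I : ℂ)‖ = |x| := by simp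
  have htaylor := Complex.exp_bound (hnorm.trans_le hx) (n := 3) (by norm_num)
  have hsum : ∑ m ∈ Finset.range 3, (x * Complex.I : ℂ) ^ m / (m.factorial : ℂ) =
      1 + x * Complex.I - x ^ 2 / 2 := by
    simp only [Finset.sum_range_succ, Finset.sum_range_zero, Nat.factorial, mul_pow, Complex.I_sq]
    push_cast
    ring
  rw [hsum, hnorm] at htaylor
  exact htaylor.trans (mul_le_of_le_one_right (by positivity) (by norm_num [Nat.factorial]))

lemma charFun_sub_quadratic_eq_integral {ν : Measure ℝ} [IsProbabilityMeasure ν]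
    (hL2 : MemLp (fun x : ℝ => x) 2 ν) (hmean : ∫ x, x ∂ν = 0) (s : ℝ) :
    charFun ν s - (1 - (∫ x, x ^ 2 ∂ν : ℝ) * (s : ℂ) ^ 2 / 2) =
      ∫ x, (Complex.exp ((s * x : ℝ) * Complex.I) -
        (1 + (s * x : ℝ) * Complex.I - ((s * x : ℝ) : ℂ) ^ 2 / 2)) ∂ν := by
  have hexp : Integrable (fun x : ℝ => Complex.exp ((s * x : ℝ) * Complex.I)) ν :=
    Integrable.of_bound (by fun_prop) 1 (ae_of_all _ fun x => by
      rw [Complex.norm_exp_ofReal_mul_I])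
  have hid : Integrable (fun x : ℝ => ((s * x : ℝ) * Complex.I : ℂ)) ν :=
    ((hL2.integrable one_le_two).const_mul s).ofReal.mul_const _
  have hlin : Integrable (fun x : ℝ => (1 + (s * x : ℝ) * Complex.I : ℂ)) ν :=
    (integrable_const _).add hid
  have hsq_eq : (fun x : ℝ => ((s * x : ℝ) : ℂ) ^ 2 / 2) =
      fun x : ℝ => ((s ^ 2 / 2 * x ^ 2 : ℝ) : ℂ) := by
    ext x
    push_cast
    ring
  have hsq : Integrable (fun x : ℝ => ((s * x : ℝ) : ℂ) ^ 2 / 2) ν :=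
    hsq_eq ▸ (hL2.integrable_sq.const_mul (s ^ 2 / 2)).ofReal
  have hquad : Integrable (fun x : ℝ =>
      (1 + (s * x : ℝ) * Complex.I - ((s * x : ℝ) : ℂ) ^ 2 / 2 : ℂ)) ν := hlin.sub hsq
  have hid_integral : ∫ x, (s * x : ℝ) * Complex.I ∂ν = 0 := by
    rw [integral_mul_const, integral_complex_ofReal, integral_const_mul, hmean]
    simp
  have hsq_integral : ∫ x, ((s * x : ℝ) : ℂ) ^ 2 / 2 ∂ν =
      (∫ x, x ^ 2 ∂ν : ℝ) * (s : ℂ) ^ 2 / 2 := by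
    rw [hsq_eq, integral_complex_ofReal, integral_const_mul]
    push_cast
    ring
  rw [integral_sub hexp hquad, integral_sub hlin hsq, integral_add (integrable_const _) hid,
    hid_integral, hsq_integral, charFun_apply_real]
  simp

section BoundedLaw

variable {ν : Measure ℝ} [IsProbabilityMeasure ν] {B : ℝ}

lemma memLp_two_of_ae_abs_le (hB : ∀ᵐ x ∂ν, |x| ≤ B) : MemLp (fun x : ℝ => x) 2 ν :=
  MemLp.of_bound aestronglyMeasurable_id B hB

lemma integral_sq_le_of_ae_abs_le (hB : ∀ᵐ x ∂ν, |x| ≤ B) : ∫ x, x ^ 2 ∂ν ≤ B ^ 2 := by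
  have hle : ∫ x, x ^ 2 ∂ν ≤ ∫ _, B ^ 2 ∂ν := by
    refine integral_mono_ae (memLp_two_of_ae_abs_le hB).integrable_sq (integrable_const _) ?_
    filter_upwards [hB] with x hx
    exact sq_le_sq' (abs_le.1 hx).1 (abs_le.1 hx).2
  simpa using hle

lemma norm_charFun_sub_quadratic_le (hB : ∀ᵐ x ∂ν, |x| ≤ B) (hmean : ∫ x, x ∂ν = 0) {s : ℝ}
    (hs : B * |s| ≤ 1) :
    ‖charFun ν s - (1 - (∫ x, x ^ 2 ∂ν : ℝ) * (s : ℂ) ^ 2 / 2)‖ ≤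
      B * (∫ x, x ^ 2 ∂ν) * |s| ^ 3 := by
  have hL2 := memLp_two_of_ae_abs_le hB
  rw [charFun_sub_quadratic_eq_integral hL2 hmean]
  calc _ ≤ ∫ x, B * |s| ^ 3 * x ^ 2 ∂ν := by
        refine norm_integral_le_of_norm_le (hL2.integrable_sq.const_mul _) ?_
        filter_upwards [hB] with x hx
        have hsx : |s * x| ≤ 1 := by
          rw [abs_mul, mul_comm]
          exact (mul_le_mul_of_nonneg_right hx (abs_nonneg s)).trans hs
        calc _ ≤ |s * x| ^ 3 := norm_exp_mul_I_sub_quadratic_le hsx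
          _ = |x| * (|s| ^ 3 * x ^ 2) := by rw [abs_mul, ← sq_abs x]; ring
          _ ≤ B * (|s| ^ 3 * x ^ 2) := by gcongr
          _ = B * |s| ^ 3 * x ^ 2 := by ring
    _ = B * (∫ x, x ^ 2 ∂ν) * |s| ^ 3 := by rw [integral_const_mul]; ring

lemma norm_charFun_sub_exp_le (hB : ∀ᵐ x ∂ν, |x| ≤ B) (hmean : ∫ x, x ∂ν = 0) {s : ℝ}
    (hs : B * |s| ≤ 1) :
    ‖charFun ν s - Real.exp (-((∫ x, x ^ 2 ∂ν) * s ^ 2 / 2))‖ ≤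
      2 * B * (∫ x, x ^ 2 ∂ν) * |s| ^ 3 := by
  set v := ∫ x, x ^ 2 ∂ν
  have : 0 ≤ v := integral_nonneg fun x => sq_nonneg x
  have hB0 : 0 ≤ B := by
    obtain ⟨x, hx⟩ := hB.exists
    exact (abs_nonneg x).trans hx
  have hvB : v * s ^ 2 ≤ B * |s| := by
    calc v * s ^ 2 ≤ B ^ 2 * |s| ^ 2 := by
          rw [sq_abs]; gcongr; exact integral_sq_le_of_ae_abs_le hB
      _ = B * |s| * (B * |s|) := by ring
      _ ≤ B * |s| := mul_le_of_le_one_right (by positivity) hs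
  have hexp : ‖(1 - (v : ℂ) * (s : ℂ) ^ 2 / 2) - Real.exp (-(v * s ^ 2 / 2))‖ ≤
      B * v * |s| ^ 3 := by
    have hnorm : ‖-(v * s ^ 2 / 2)‖ = v * s ^ 2 / 2 := by
      rw [norm_neg, Real.norm_of_nonneg (by positivity)]
    have hle := Real.norm_exp_sub_one_sub_id_le (hnorm.trans_le (by linarith))
    calc _ = ‖Real.exp (-(v * s ^ 2 / 2)) - 1 - -(v * s ^ 2 / 2)‖ := by
          rw [norm_sub_rev, ← Complex.norm_real]; push_cast; ring_nf
      _ ≤ (v * s ^ 2 / 2) ^ 2 := hle.trans_eq (by rw [hnorm])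
      _ = v * s ^ 2 * (v * s ^ 2) / 4 := by ring
      _ ≤ v * s ^ 2 * (B * |s|) / 4 := by gcongr
      _ ≤ v * s ^ 2 * (B * |s|) := by linarith [show 0 ≤ v * s ^ 2 * (B * |s|) by positivity]
      _ = B * v * |s| ^ 3 := by rw [← sq_abs]; ring
  calc _ ≤ ‖charFun ν s - (1 - (v : ℂ) * (s : ℂ) ^ 2 / 2)‖ +
        ‖(1 - (v : ℂ) * (s : ℂ) ^ 2 / 2) - Real.exp (-(v * s ^ 2 / 2))‖ :=
        norm_sub_le_norm_sub_add_norm_sub _ _ _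
    _ ≤ B * v * |s| ^ 3 + B * v * |s| ^ 3 :=
        add_le_add (norm_charFun_sub_quadratic_le hB hmean hs) hexp
    _ = 2 * B * v * |s| ^ 3 := by ring

lemma norm_charFun_pow_sub_exp_le (hB : ∀ᵐ x ∂ν, |x| ≤ B) (hmean : ∫ x, x ∂ν = 0) {N : ℕ} {a : ℝ}
    (ha : 0 ≤ a) (hvar : N * (∫ x, x ^ 2 ∂ν) * a ^ 2 = 1) {t : ℝ} (ht : B * a * |t| ≤ 1) :
    ‖charFun ν (a * t) ^ N - Real.exp (-(t ^ 2 / 2))‖ ≤ 2 * (B * a) * |t| ^ 3 := by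
  set v := ∫ x, x ^ 2 ∂ν
  have habs : |a * t| = a * |t| := by rw [abs_mul, abs_of_nonneg ha]
  have hpow : (Real.exp (-(t ^ 2 / 2)) : ℂ) = (Real.exp (-(v * (a * t) ^ 2 / 2)) : ℂ) ^ N := by
    rw [← Complex.ofReal_pow, ← Real.exp_nat_mul]
    congr 2
    linear_combination t ^ 2 / 2 * hvar
  have hexp_le : ‖(Real.exp (-(v * (a * t) ^ 2 / 2)) : ℂ)‖ ≤ 1 := by
    rw [Complex.norm_real, Real.norm_of_nonneg (Real.exp_nonneg _), Real.exp_le_one_iff, neg_nonpos]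
    have : 0 ≤ v := integral_nonneg fun x => sq_nonneg x
    positivity
  calc _ ≤ N * ‖charFun ν (a * t) - Real.exp (-(v * (a * t) ^ 2 / 2))‖ := by
        rw [hpow]
        exact norm_pow_sub_pow_le_nat_mul (norm_charFun_le_one _) hexp_le N
    _ ≤ N * (2 * B * v * |a * t| ^ 3) := by
        gcongr
        exact norm_charFun_sub_exp_le hB hmean (by rwa [habs, ← mul_assoc])
    _ = N * v * a ^ 2 * (2 * (B * a) * |t| ^ 3) := by rw [habs]; ring
    _ = 2 * (B * a) * |t| ^ 3 := by rw [hvar, one_mul]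

end BoundedLaw

/-- The law of the sum of `N` independent variables with common law `ν`. -/
def sumLaw (N : ℕ) (ν : Measure ℝ) : Measure ℝ :=
  (Measure.pi fun _ : Fin N => ν).map fun x => ∑ i, x i

section SumLaw

variable {ν : Measure ℝ} [IsProbabilityMeasure ν]

instance (N : ℕ) : IsProbabilityMeasure (sumLaw N ν) :=
  Measure.isProbabilityMeasure_map (by fun_prop)

lemma charFun_sumLaw (N : ℕ) (t : ℝ) : charFun (sumLaw N ν) t = charFun ν t ^ N := by
  rw [sumLaw, charFun_map_sum_pi_eq_prod]
  simp

lemma sumLaw_map_add_const (N : ℕ) (b : ℝ) :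
    sumLaw N (ν.map (· + b)) = (sumLaw N ν).map (· + N * b) := by
  have : IsProbabilityMeasure (ν.map (· + b)) := Measure.isProbabilityMeasure_map (by fun_prop)
  rw [sumLaw, ← Measure.pi_map_pi (fun _ => by fun_prop), sumLaw,
    Measure.map_map (by fun_prop) (by fun_prop), Measure.map_map (by fun_prop) (by fun_prop)]
  congr 1 with x
  simp [Finset.sum_add_distrib]

end SumLaw

section Standardize

variable {ν : Measure ℝ}

lemma integral_sq_map_sub_integral :
    ∫ x, x ^ 2 ∂(ν.map (· + -∫ y, y ∂ν)) = Var[id; ν] := by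
  rw [integral_map (by fun_prop) (by fun_prop), variance_eq_integral aemeasurable_id]
  simp only [id, sub_eq_add_neg]

variable [IsProbabilityMeasure ν]

lemma integral_map_sub_integral (hν : Integrable (fun x : ℝ => x) ν) :
    ∫ x, x ∂(ν.map (· + -∫ y, y ∂ν)) = 0 := by
  rw [integral_map (by fun_prop) (by fun_prop), integral_add hν (integrable_const _)]
  simp

lemma sumLaw_map_standardize (N : ℕ) (a : ℝ) :
    (sumLaw N ν).map (fun x => a * x + -(a * (N * ∫ y, y ∂ν))) =
      (sumLaw N (ν.map (· + -∫ y, y ∂ν))).map (a * ·) := by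
  rw [sumLaw_map_add_const, Measure.map_map (by fun_prop) (by fun_prop)]
  congr 1 with x
  simp only [Function.comp]
  ring

lemma gaussianReal_map_standardize {m v a : ℝ} (h : v * a ^ 2 = 1) :
    (gaussianReal m v.toNNReal).map (fun x => a * x + -(a * m)) = gaussianReal 0 1 := by
  have hv : 0 ≤ v := by nlinarith [sq_nonneg a]
  change (gaussianReal m v.toNNReal).map ((· + -(a * m)) ∘ (a * ·)) = _
  rw [← Measure.map_map (by fun_prop) (by fun_prop), gaussianReal_map_const_mul,
    gaussianReal_map_add_const, add_neg_cancel]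
  congr 1
  ext
  rw [NNReal.coe_mul, Real.coe_toNNReal _ hv, NNReal.coe_mk, NNReal.coe_one, mul_comm, h]

end Standardize

lemma tendsto_charFun_sumLaw_map_mul {ν : ℕ → Measure ℝ} [∀ n, IsProbabilityMeasure (ν n)]
    {N : ℕ → ℕ} {a B : ℕ → ℝ} (hB : ∀ n, ∀ᵐ x ∂ν n, |x| ≤ B n) (hmean : ∀ n, ∫ x, x ∂ν n = 0)
    (ha : ∀ n, 0 ≤ a n) (hvar : ∀ n, N n * (∫ x, x ^ 2 ∂ν n) * a n ^ 2 = 1)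
    (hlim : Tendsto (fun n => B n * a n) atTop (𝓝 0)) (t : ℝ) :
    Tendsto (fun n => charFun ((sumLaw (N n) (ν n)).map (a n * ·)) t) atTop
      (𝓝 (charFun (gaussianReal 0 1) t)) := by
  have hsmall : ∀ s : ℝ, Tendsto (fun n => B n * a n * s) atTop (𝓝 0) := fun s => by
    simpa only [zero_mul] using hlim.mul_const s
  have hgauss : charFun (gaussianReal 0 1) t = Real.exp (-(t ^ 2 / 2)) := by
    simp [charFun_gaussianReal]
  rw [hgauss, tendsto_iff_norm_sub_tendsto_zero]
  refine squeeze_zero' (Eventually.of_forall fun _ => norm_nonneg _) ?_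
    (by simpa using (hsmall (|t| ^ 3)).const_mul 2)
  filter_upwards [(hsmall |t|).eventually (gt_mem_nhds one_pos)] with n hn
  rw [charFun_map_mul, charFun_sumLaw, ← mul_assoc]
  exact norm_charFun_pow_sub_exp_le (hB n) (hmean n) (ha n) (hvar n) hn.le

lemma tendsto_kolmogorovDist_sumLaw {ν : ℕ → Measure ℝ} [∀ n, IsProbabilityMeasure (ν n)]
    {N : ℕ → ℕ} {B : ℕ → ℝ} (hB : ∀ n, ∀ᵐ x ∂ν n, |x - ∫ y, y ∂ν n| ≤ B n)
    (hvar : ∀ n, 0 < N n * Var[id; ν n])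
    (hlim : Tendsto (fun n => B n / √(N n * Var[id; ν n])) atTop (𝓝 0)) :
    Tendsto (fun n => kolmogorovDist (sumLaw (N n) (ν n))
      (gaussianReal (N n * ∫ x, x ∂ν n) (N n * Var[id; ν n]).toNNReal)) atTop (𝓝 0) := by
  set a : ℕ → ℝ := fun n => (√(N n * Var[id; ν n]))⁻¹ with ha
  set c : ℕ → Measure ℝ := fun n => (ν n).map (· + -∫ y, y ∂ν n) with hc
  have ha_pos : ∀ n, 0 < a n := fun n => inv_pos.2 (Real.sqrt_pos.2 (hvar n))
  have ha_sq : ∀ n, N n * Var[id; ν n] * a n ^ 2 = 1 := fun n => by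
    rw [ha, inv_pow, Real.sq_sqrt (hvar n).le, mul_inv_cancel₀ (hvar n).ne']
  have hc_prob : ∀ n, IsProbabilityMeasure (c n) := fun n =>
    Measure.isProbabilityMeasure_map (by fun_prop)
  have hc_bound : ∀ n, ∀ᵐ x ∂c n, |x| ≤ B n := fun n =>
    (ae_map_iff (by fun_prop) (measurableSet_le (by fun_prop) (by fun_prop))).2 (hB n)
  have hc_mean : ∀ n, ∫ x, x ∂c n = 0 := fun n => by
    have hint : Integrable (fun x : ℝ => x - ∫ y, y ∂ν n) (ν n) :=
      Integrable.of_bound (by fun_prop) (B n) (hB n)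
    refine integral_map_sub_integral ((hint.add (integrable_const (∫ y, y ∂ν n))).congr ?_)
    exact ae_of_all _ fun x => sub_add_cancel x _
  have hc_var : ∀ n, N n * (∫ x, x ^ 2 ∂c n) * a n ^ 2 = 1 := fun n => by
    rw [hc, integral_sq_map_sub_integral, ha_sq]
  have hmap_prob : ∀ n, IsProbabilityMeasure ((sumLaw (N n) (c n)).map (a n * ·)) := fun n =>
    Measure.isProbabilityMeasure_map (by fun_prop)
  have : NullSingletonClass (gaussianReal 0 1) := nullSingletonClass_gaussianReal one_ne_zero
  refine (tendsto_kolmogorovDist_of_tendsto_charFun (tendsto_charFun_sumLaw_map_mul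
    hc_bound hc_mean (fun n => (ha_pos n).le) hc_var hlim)).congr fun n => ?_
  rw [hc, ← sumLaw_map_standardize, ← gaussianReal_map_standardize (ha_sq n),
    kolmogorovDist_map_mul_add (ha_pos n)]

theorem exists_forall_kolmogorovDist_sumLaw_le {ε : ℝ} (hε : 0 < ε) :
    ∃ δ > 0, ∀ (N : ℕ) (ν : Measure ℝ) [IsProbabilityMeasure ν] (B : ℝ),
      (∀ᵐ x ∂ν, |x - ∫ y, y ∂ν| ≤ B) → 0 < N * Var[id; ν] → B ≤ δ * √(N * Var[id; ν]) →
      kolmogorovDist (sumLaw N ν)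
        (gaussianReal (N * ∫ x, x ∂ν) (N * Var[id; ν]).toNNReal) ≤ ε := by
  by_contra! hcontra
  choose N ν hν B hB hvar hsmall hdist using fun n : ℕ =>
    hcontra (1 / ((n : ℝ) + 1)) (by positivity)
  have hratio : Tendsto (fun n => B n / √(N n * Var[id; ν n])) atTop (𝓝 0) := by
    refine squeeze_zero (fun n => ?_) (fun n => ?_) tendsto_one_div_add_atTop_nhds_zero_nat
    · obtain ⟨x, hx⟩ := (hB n).exists
      exact div_nonneg ((abs_nonneg _).trans hx) (Real.sqrt_nonneg _)
    · exact (div_le_iff₀ (Real.sqrt_pos.2 (hvar n))).2 (hsmall n)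
  obtain ⟨n, hn⟩ := ((tendsto_kolmogorovDist_sumLaw hB hvar hratio).eventually
    (gt_mem_nhds hε)).exists
  exact (hdist n).not_gt hn

/-! ### Order statistics of a sample with a continuous law -/

lemma sum_orderStat_Icc {n : ℕ} (x : Fin n → ℝ) {a b : ℕ} (hb : b ≤ n) :
    ∑ i ∈ Finset.Icc (a + 1) b, orderStat x i =
      ∑ j ∈ Finset.univ.filter fun j : Fin n => a ≤ j ∧ j < b, x (Tuple.sort x j) := by
  symm
  refine Finset.sum_bij (fun j _ => (j : ℕ) + 1) ?_ ?_ ?_ ?_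
  · intro j hj
    simp only [Finset.mem_filter, Finset.mem_univ, true_and] at hj
    exact Finset.mem_Icc.2 (by omega)
  · exact fun i _ j _ hij => Fin.ext (Nat.succ_injective hij)
  · intro i hi
    rw [Finset.mem_Icc] at hi
    exact ⟨⟨i - 1, by omega⟩, by simp; omega, by simp; omega⟩
  · intro j _
    rw [orderStat, dif_pos ⟨by omega, by omega⟩]
    simp

lemma sum_eq_trimmedSum_add_pivot_add_topSum {n k : ℕ} (hk : 0 < k) (hkn : k ≤ n)
    (x : Fin n → ℝ) : ∑ i, x i = trimmedSum x k + pivot x k + topSum x k := by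
  have hsort : ∑ i, x i = ∑ j ∈ Finset.Icc 1 n, orderStat x j := by
    rw [sum_orderStat_Icc x (a := 0) le_rfl, ← Equiv.sum_comp (Tuple.sort x)]
    simp
  have hIcc : ∀ a b : ℕ, Finset.Icc a b = Finset.Ico a (b + 1) := fun a b => by
    ext; simp
  rw [hsort, trimmedSum, pivot, topSum, hIcc, hIcc, hIcc,
    ← Finset.sum_Ico_consecutive (orderStat x) (show 1 ≤ n - k + 1 by omega) (by omega),
    Finset.sum_eq_sum_Ico_succ_bot (show n - k + 1 < n + 1 by omega), ← add_assoc]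

section Blocks

variable {n : ℕ}

/-- The samples that are partitioned by their entry at `p`: the entries before `p` are smaller, the
entries after `p` are larger than it. -/
def blockSet (p : Fin n) : Set (Fin n → ℝ) := {x | ∀ j, cmp (x j) (x p) = cmp j p}

lemma mem_blockSet_iff {p : Fin n} {x : Fin n → ℝ} :
    x ∈ blockSet p ↔ (∀ j < p, x j < x p) ∧ ∀ j > p, x p < x j := by
  refine ⟨fun h => ⟨fun j hj => (lt_iff_lt_of_cmp_eq_cmp (h j)).2 hj,
    fun j hj => (lt_iff_lt_of_cmp_eq_cmp (cmp_eq_cmp_symm.1 (h j))).2 hj⟩, fun h j => ?_⟩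
  rcases lt_trichotomy j p with hj | rfl | hj
  · rw [hj.cmp_eq_lt, (h.1 j hj).cmp_eq_lt]
  · rw [cmp_self_eq_eq, cmp_self_eq_eq]
  · rw [hj.cmp_eq_gt, (h.2 j hj).cmp_eq_gt]

lemma measurableSet_blockSet (p : Fin n) : MeasurableSet (blockSet p) := by
  have : blockSet p =
      (⋂ j, ⋂ (_ : j < p), {x | x j < x p}) ∩ ⋂ j, ⋂ (_ : p < j), {x | x p < x j} := by
    ext x
    simp [mem_blockSet_iff]
  rw [this]
  refine MeasurableSet.inter ?_ ?_ <;>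
  exact MeasurableSet.iInter fun j => MeasurableSet.iInter fun _ =>
    measurableSet_lt (measurable_pi_apply _) (measurable_pi_apply _)

lemma forall_cmp_perm_iff (p : Fin n) (τ : Equiv.Perm (Fin n)) :
    (∀ j, cmp (τ j) (τ p) = cmp j p) ↔ ∀ j, cmp (τ j) p = cmp j p := by
  suffices (∀ j, cmp (τ j) (τ p) = cmp j p) ∨ (∀ j, cmp (τ j) p = cmp j p) → τ p = p from
    ⟨fun h => by simpa only [this (.inl h)] using h, fun h => by simpa only [this (.inr h)] using h⟩
  rintro (h | h)
  · have himage : (Finset.Iio p).map τ.toEmbedding = Finset.Iio (τ p) := by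
      ext i
      rw [Finset.mem_map_equiv, Finset.mem_Iio, Finset.mem_Iio, ← lt_iff_lt_of_cmp_eq_cmp (h _),
        Equiv.apply_symm_apply]
    have hcard := congrArg Finset.card himage
    rw [Finset.card_map, Fin.card_Iio, Fin.card_Iio] at hcard
    exact (Fin.ext hcard).symm
  · exact cmp_eq_eq_iff _ _ |>.1 ((h p).trans (cmp_self_eq_eq p))

lemma comp_perm_mem_blockSet_iff {z : Fin n → ℝ} (hz : StrictMono z) (p : Fin n)
    (τ : Equiv.Perm (Fin n)) : z ∘ τ ∈ blockSet p ↔ (cmp · p) ∘ τ = (cmp · p) := by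
  simp only [blockSet, mem_ofPred_eq, Function.comp_apply, hz.cmp_map_eq, funext_iff]
  exact forall_cmp_perm_iff p τ

lemma card_perm_cmp_comp_eq (p : Fin n) :
    Fintype.card {τ : Equiv.Perm (Fin n) // (cmp · p) ∘ τ = (cmp · p)} =
      (p : ℕ).factorial * (n - p - 1).factorial := by
  have hlt : Fintype.card {j // cmp j p = Ordering.lt} = p := by
    rw [Fintype.card_subtype, ← Fin.card_Iio p]
    congr 1 with j
    simp [cmp_eq_lt_iff]
  have heq : Fintype.card {j // cmp j p = Ordering.eq} = 1 := by
    rw [Fintype.card_subtype, ← Finset.card_singleton p]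
    congr 1 with j
    simp [cmp_eq_eq_iff]
  have hgt : Fintype.card {j // cmp j p = Ordering.gt} = n - p - 1 := by
    rw [Fintype.card_subtype, Nat.sub_right_comm, ← Fin.card_Ioi p]
    congr 1 with j
    simp [cmp_eq_gt_iff]
  rw [DomMulAct.stabilizer_card,
    show (Finset.univ : Finset Ordering) = {Ordering.lt, Ordering.eq, Ordering.gt} by decide,
    Finset.prod_insert (by decide), Finset.prod_insert (by decide), Finset.prod_singleton,
    hlt, heq, hgt]
  simp

/-- The entry at `p`, the sum of the entries before `p` and the sum of the entries after `p`. -/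
def blockSums (p : Fin n) (x : Fin n → ℝ) : ℝ × ℝ × ℝ :=
  (x p, ∑ j ∈ Finset.Iio p, x j, ∑ j ∈ Finset.Ioi p, x j)

lemma measurable_blockSums (p : Fin n) : Measurable (blockSums p) := by
  unfold blockSums
  fun_prop

lemma blockSums_comp_perm (z : Fin n → ℝ) {p : Fin n} {τ : Equiv.Perm (Fin n)}
    (hτ : (cmp · p) ∘ τ = (cmp · p)) : blockSums p (z ∘ τ) = blockSums p z := by
  have hcmp : ∀ j, cmp j p = cmp (τ j) p := fun j => (congrFun hτ j).symm
  have hfix : τ p = p := (eq_iff_eq_of_cmp_eq_cmp (hcmp p)).1 rfl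
  refine Prod.ext (congrArg z hfix) (Prod.ext ?_ ?_)
  · refine Finset.sum_equiv τ (fun j => ?_) fun _ _ => rfl
    rw [Finset.mem_Iio, Finset.mem_Iio, lt_iff_lt_of_cmp_eq_cmp (hcmp j)]
  · refine Finset.sum_equiv τ (fun j => ?_) fun _ _ => rfl
    rw [Finset.mem_Ioi, Finset.mem_Ioi, lt_iff_lt_of_cmp_eq_cmp (cmp_eq_cmp_symm.1 (hcmp j))]

lemma blockSums_comp_sort {p : Fin n} {k : ℕ} (hp : p + k = n) (x : Fin n → ℝ) :
    blockSums p (x ∘ Tuple.sort x) = (pivot x k, trimmedSum x k, topSum x k) := by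
  have hsub : n - k = p := by omega
  refine Prod.ext ?_ (Prod.ext ?_ ?_)
  · simp only [blockSums, pivot, hsub]
    rw [orderStat, dif_pos ⟨by omega, by omega⟩]
    rfl
  · simp only [blockSums, trimmedSum, hsub]
    rw [sum_orderStat_Icc x (a := 0) (by omega)]
    refine Finset.sum_congr (Finset.ext fun j => ?_) fun _ _ => rfl
    simp only [Finset.mem_Iio, Fin.lt_def, Finset.mem_filter, Finset.mem_univ, true_and]
    omega
  · simp only [blockSums, topSum, hsub]
    rw [sum_orderStat_Icc x (a := p + 1) le_rfl]
    refine Finset.sum_congr (Finset.ext fun j => ?_) fun _ _ => rfl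
    simp only [Finset.mem_Ioi, Fin.lt_def, Finset.mem_filter, Finset.mem_univ, true_and]
    omega

/-- Only the permutations that put the `p` smallest entries first and the `k - 1` largest entries
last contribute. -/
lemma sum_indicator_blockSet_comp_perm {p : Fin n} {k : ℕ} (hp : p + k = n)
    (F : ℝ × ℝ × ℝ → ENNReal) {x : Fin n → ℝ} (hx : Function.Injective x) :
    ∑ τ : Equiv.Perm (Fin n), (blockSet p).indicator (F ∘ blockSums p) (x ∘ τ) =
      ((p : ℕ).factorial * (k - 1).factorial : ℕ) *
        F (pivot x k, trimmedSum x k, topSum x k) := by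
  have hz : StrictMono (x ∘ Tuple.sort x) :=
    (Tuple.monotone_sort x).strictMono_of_injective (hx.comp (Tuple.sort x).injective)
  have hterm : ∀ τ : Equiv.Perm (Fin n),
      (blockSet p).indicator (F ∘ blockSums p) ((x ∘ Tuple.sort x) ∘ τ) =
        if (cmp · p) ∘ τ = (cmp · p) then F (blockSums p (x ∘ Tuple.sort x)) else 0 := fun τ => by
    split_ifs with h
    · rw [indicator_of_mem ((comp_perm_mem_blockSet_iff hz p τ).2 h), Function.comp_apply,
        blockSums_comp_perm _ h]
    · exact indicator_of_notMem (mt (comp_perm_mem_blockSet_iff hz p τ).1 h) _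
  rw [← Equiv.sum_comp (Equiv.mulLeft (Tuple.sort x)), ← blockSums_comp_sort hp x]
  refine (Finset.sum_congr rfl fun τ _ => hterm τ).trans ?_
  rw [← Finset.sum_filter, Finset.sum_const, nsmul_eq_mul, ← Fintype.card_subtype,
    card_perm_cmp_comp_eq, show n - (p : ℕ) - 1 = k - 1 by omega]

end Blocks

section Exchangeable

variable {ι : Type*} [Fintype ι] (μ : Measure ℝ) [IsProbabilityMeasure μ]

lemma ae_injective_pi [NullSingletonClass μ] :
    ∀ᵐ x ∂(Measure.pi fun _ : ι => μ), Function.Injective x := by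
  have hne : ∀ i j : ι, i ≠ j → ∀ᵐ x ∂(Measure.pi fun _ : ι => μ), x i ≠ x j := fun i j hij => by
    have hind : IndepFun (fun x : ι → ℝ => x i) (fun x => x j) (Measure.pi fun _ : ι => μ) :=
      (iIndepFun_pi (X := fun _ x => x) fun _ => aemeasurable_id).indepFun hij
    have hmap := (indepFun_iff_map_prod_eq_prod_map_map (measurable_pi_apply i).aemeasurable
      (measurable_pi_apply j).aemeasurable).1 hind
    simp only [(measurePreserving_eval (fun _ : ι => μ) _).map_eq] at hmap
    have hdiag : ∀ᵐ q ∂(μ.prod μ), q.1 ≠ q.2 := by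
      rw [Measure.ae_prod_iff_ae_ae (by measurability)]
      exact ae_of_all _ fun a => (measure_eq_zero_iff_ae_notMem.1 (measure_singleton a)).mono
        fun b hb h => hb h.symm
    rw [← hmap] at hdiag
    exact ae_of_ae_map (f := fun x : ι → ℝ => (x i, x j)) (by fun_prop) hdiag
  filter_upwards [ae_all_iff.2 fun i => ae_all_iff.2 fun j => ae_all_iff.2 (hne i j)]
    with x hx i j hij
  exact not_ne_iff.1 fun h => hx i j h hij

lemma measurePreserving_comp_perm (τ : Equiv.Perm ι) :
    MeasurePreserving (fun x : ι → ℝ => x ∘ τ) (Measure.pi fun _ : ι => μ)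
      (Measure.pi fun _ : ι => μ) :=
  measurePreserving_arrowCongr' (fun _ => μ) (fun _ => μ) τ.symm (MeasurableEquiv.refl ℝ)
    fun _ => MeasurePreserving.id μ

lemma lintegral_sum_comp_perm [DecidableEq ι] {g : (ι → ℝ) → ENNReal} (hg : Measurable g) :
    ∫⁻ x, ∑ τ : Equiv.Perm ι, g (x ∘ τ) ∂(Measure.pi fun _ : ι => μ) =
      (Fintype.card ι).factorial * ∫⁻ x, g x ∂(Measure.pi fun _ : ι => μ) := by
  have hmeas : ∀ τ : Equiv.Perm ι, Measurable fun x : ι → ℝ => g (x ∘ τ) := fun τ =>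
    hg.comp (measurePreserving_comp_perm μ τ).measurable
  rw [lintegral_finsetSum _ fun τ _ => hmeas τ]
  simp only [(measurePreserving_comp_perm μ _).lintegral_comp hg, Finset.sum_const,
    Finset.card_univ, Fintype.card_perm, nsmul_eq_mul]

lemma lintegral_pivot_trimmedSum_topSum [NullSingletonClass μ] {n k : ℕ} {p : Fin n}
    (hp : p + k = n) {F : ℝ × ℝ × ℝ → ENNReal} (hF : Measurable F) :
    ((p : ℕ).factorial * (k - 1).factorial : ℕ) *
      ∫⁻ x, F (pivot x k, trimmedSum x k, topSum x k) ∂(Measure.pi fun _ : Fin n => μ) =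
    n.factorial * ∫⁻ x, (blockSet p).indicator (F ∘ blockSums p) x
      ∂(Measure.pi fun _ : Fin n => μ) := by
  have hsum := lintegral_sum_comp_perm μ ((hF.comp (measurable_blockSums p)).indicator
    (measurableSet_blockSet p))
  rw [Fintype.card_fin] at hsum
  rw [← hsum, ← lintegral_const_mul' _ _ (ENNReal.natCast_ne_top _)]
  refine lintegral_congr_ae ?_
  filter_upwards [ae_injective_pi μ] with x hx
  exact (sum_indicator_blockSet_comp_perm hp F hx).symm

end Exchangeable

section Glue

variable {m r : ℕ}

/-- The sample of size `m + 1 + r` made of `m` lower entries, the pivot and `r` upper entries. -/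
def glue (q : ℝ × (Fin m → ℝ) × (Fin r → ℝ)) : Fin (m + 1 + r) → ℝ :=
  Fin.append (Fin.snoc q.2.1 q.1 : Fin (m + 1) → ℝ) q.2.2

/-- The index of the pivot in a sample of size `m + 1 + r`. -/
def mid (m r : ℕ) : Fin (m + 1 + r) := Fin.castAdd r (Fin.last m)

@[simp] lemma glue_lower (q : ℝ × (Fin m → ℝ) × (Fin r → ℝ)) (i : Fin m) :
    glue q (Fin.castAdd r i.castSucc) = q.2.1 i := by
  simp [glue]

@[simp] lemma glue_mid (q : ℝ × (Fin m → ℝ) × (Fin r → ℝ)) : glue q (mid m r) = q.1 := by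
  simp [glue, mid]

@[simp] lemma glue_upper (q : ℝ × (Fin m → ℝ) × (Fin r → ℝ)) (i : Fin r) :
    glue q (Fin.natAdd (m + 1) i) = q.2.2 i := by
  simp [glue]

@[simp] lemma lower_lt_mid (i : Fin m) : Fin.castAdd r i.castSucc < mid m r := by
  simp [mid, Fin.lt_def]

@[simp] lemma mid_lt_upper (i : Fin r) : mid m r < Fin.natAdd (m + 1) i := by
  simp [mid, Fin.lt_def]
  omega

lemma forall_fin_block_iff {C : Fin (m + 1 + r) → Prop} :
    (∀ j, C j) ↔ (∀ i : Fin m, C (Fin.castAdd r i.castSucc)) ∧ C (mid m r) ∧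
      ∀ i : Fin r, C (Fin.natAdd (m + 1) i) :=
  ⟨fun h => ⟨fun _ => h _, h _, fun _ => h _⟩,
    fun ⟨hl, hm, hu⟩ j => Fin.addCases (fun i => Fin.lastCases hm hl i) hu j⟩

lemma measurable_glue : Measurable (glue : ℝ × (Fin m → ℝ) × (Fin r → ℝ) → _) := by
  refine measurable_pi_iff.2 (forall_fin_block_iff.2 ⟨fun i => ?_, ?_, fun i => ?_⟩)
  · simp only [glue_lower]; fun_prop
  · simp only [glue_mid]; fun_prop
  · simp only [glue_upper]; fun_prop

lemma map_glue (μ : Measure ℝ) [IsProbabilityMeasure μ] :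
    (μ.prod ((Measure.pi fun _ : Fin m => μ).prod (Measure.pi fun _ : Fin r => μ))).map glue =
      Measure.pi fun _ : Fin (m + 1 + r) => μ := by
  refine (Measure.pi_eq fun s hs => ?_).symm
  have hpre : glue ⁻¹' (univ.pi s) = s (mid m r) ×ˢ
      ((univ.pi fun i : Fin m => s (Fin.castAdd r i.castSucc)) ×ˢ
        (univ.pi fun i : Fin r => s (Fin.natAdd (m + 1) i))) := by
    ext q
    simp only [mem_preimage, mem_univ_pi, mem_prod]
    rw [forall_fin_block_iff]
    simp only [glue_lower, glue_mid, glue_upper]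
    exact and_left_comm
  rw [Measure.map_apply measurable_glue (MeasurableSet.univ_pi hs), hpre, Measure.prod_prod,
    Measure.prod_prod, Measure.pi_pi, Measure.pi_pi, Fin.prod_univ_add, Fin.prod_univ_castSucc, mid]
  ring

lemma glue_mem_blockSet_iff (q : ℝ × (Fin m → ℝ) × (Fin r → ℝ)) :
    glue q ∈ blockSet (mid m r) ↔
      q.2 ∈ (univ.pi fun _ : Fin m => Iio q.1) ×ˢ (univ.pi fun _ : Fin r => Ioi q.1) := by
  rw [mem_blockSet_iff, forall_fin_block_iff, forall_fin_block_iff]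
  simp [(lower_lt_mid _).not_gt, (mid_lt_upper _).not_gt]

lemma blockSums_glue (q : ℝ × (Fin m → ℝ) × (Fin r → ℝ)) :
    blockSums (mid m r) (glue q) = (q.1, ∑ i, q.2.1 i, ∑ i, q.2.2 i) := by
  have hsplit : ∀ f : Fin (m + 1 + r) → ℝ, ∑ j, f j = ∑ i : Fin m, f (Fin.castAdd r i.castSucc) +
      f (mid m r) + ∑ i : Fin r, f (Fin.natAdd (m + 1) i) := fun f => by
    rw [Fin.sum_univ_add, Fin.sum_univ_castSucc, mid]
  simp only [blockSums, ← Finset.filter_lt_eq_Ioi, ← Finset.filter_gt_eq_Iio, Finset.sum_filter]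
  rw [hsplit, hsplit]
  simp [(lower_lt_mid _).not_gt, (mid_lt_upper _).not_gt]

lemma restrict_univ_pi_eq_smul_pi_cond {ι : Type*} [Fintype ι] (μ : Measure ℝ)
    [IsProbabilityMeasure μ] {S : Set ℝ} (hS : MeasurableSet S) :
    (Measure.pi fun _ : ι => μ).restrict (univ.pi fun _ => S) =
      μ S ^ Fintype.card ι • Measure.pi fun _ : ι => μ[|S] := by
  rw [Measure.restrict_pi_pi]
  refine Measure.pi_eq fun s hs => ?_
  simp only [Measure.smul_apply, Measure.pi_pi, smul_eq_mul]
  rw [← Finset.card_univ, ← Finset.prod_const, ← Finset.prod_mul_distrib]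
  refine Finset.prod_congr rfl fun i _ => ?_
  rw [mul_comm, cond_mul_eq_inter hS, Measure.restrict_apply (hs i), inter_comm]

lemma lintegral_indicator_blockSet (μ : Measure ℝ) [IsProbabilityMeasure μ]
    {F : ℝ × ℝ × ℝ → ENNReal} (hF : Measurable F) :
    ∫⁻ x, (blockSet (mid m r)).indicator (F ∘ blockSums (mid m r)) x
        ∂(Measure.pi fun _ : Fin (m + 1 + r) => μ) =
      ∫⁻ y, μ (Iio y) ^ m * μ (Ioi y) ^ r *
        ∫⁻ q, F (y, q) ∂((sumLaw m μ[|Iio y]).prod (sumLaw r μ[|Ioi y])) ∂μ := by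
  have hmeas : Measurable ((blockSet (mid m r)).indicator (F ∘ blockSums (mid m r))) :=
    (hF.comp (measurable_blockSums _)).indicator (measurableSet_blockSet _)
  have hglue_meas : Measurable fun q : ℝ × (Fin m → ℝ) × (Fin r → ℝ) =>
      (blockSet (mid m r)).indicator (F ∘ blockSums (mid m r)) (glue q) :=
    hmeas.comp measurable_glue
  rw [← map_glue, lintegral_map hmeas measurable_glue, lintegral_prod _ hglue_meas.aemeasurable]
  refine lintegral_congr fun y => ?_
  have hglue : ∀ q : (Fin m → ℝ) × (Fin r → ℝ),
      (blockSet (mid m r)).indicator (F ∘ blockSums (mid m r)) (glue (y, q)) =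
        ((univ.pi fun _ => Iio y) ×ˢ (univ.pi fun _ => Ioi y)).indicator
          (fun q : (Fin m → ℝ) × (Fin r → ℝ) => F (y, ∑ i, q.1 i, ∑ i, q.2 i)) q := fun q => by
    classical
    simp only [indicator_apply, glue_mem_blockSet_iff, Function.comp_apply, blockSums_glue]
  simp only [hglue]
  rw [lintegral_indicator ((MeasurableSet.univ_pi fun _ => measurableSet_Iio).prod
      (MeasurableSet.univ_pi fun _ => measurableSet_Ioi)), ← Measure.prod_restrict,
    restrict_univ_pi_eq_smul_pi_cond _ measurableSet_Iio,
    restrict_univ_pi_eq_smul_pi_cond _ measurableSet_Ioi, Measure.prod_smul_left,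
    Measure.prod_smul_right, lintegral_smul_measure, lintegral_smul_measure, smul_eq_mul,
    smul_eq_mul, ← mul_assoc, Fintype.card_fin, Fintype.card_fin, sumLaw, sumLaw,
    Measure.map_prod_map _ _ (by fun_prop) (by fun_prop),
    lintegral_map (by fun_prop) (by fun_prop)]
  rfl

end Glue

/-! ### The Pareto law and its truncations -/

lemma paretoMeasure_eq_withDensity_restrict (t α : ℝ) :
    paretoMeasure t α = (volume.restrict (Ioi t)).withDensity
      (fun x => ENNReal.ofReal (α * t ^ α * x ^ (-(α + 1)))) := by
  rw [paretoMeasure, Measure.restrict_congr_set Ioi_ae_eq_Ici,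
    ← withDensity_indicator measurableSet_Ici]
  congr 1
  ext x
  by_cases h : t ≤ x
  · rw [paretoPDF_of_le h, indicator_of_mem (mem_Ici.2 h)]
  · rw [paretoPDF_of_lt (not_le.1 h), indicator_of_notMem (by simpa using h)]

instance (t α : ℝ) : NullSingletonClass (paretoMeasure t α) := by
  rw [paretoMeasure]; infer_instance

lemma ae_paretoMeasure_mem_Ioi (t α : ℝ) : ∀ᵐ x ∂(paretoMeasure t α), x ∈ Ioi t := by
  rw [paretoMeasure_eq_withDensity_restrict]
  exact withDensity_absolutelyContinuous _ _ (ae_restrict_mem measurableSet_Ioi)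

lemma lintegral_paretoMeasure (t α : ℝ) (g : ℝ → ENNReal) :
    ∫⁻ y, g y ∂(paretoMeasure t α) =
      ∫⁻ y in Ioi t, ENNReal.ofReal (α * t ^ α * y ^ (-(α + 1))) * g y := by
  rw [paretoMeasure_eq_withDensity_restrict,
    lintegral_withDensity_eq_lintegral_mul_non_measurable _ (by fun_prop)
      (ae_of_all _ fun _ => ENNReal.ofReal_lt_top)]
  rfl

lemma paretoMeasure_Ioi {t α y : ℝ} (ht : 0 < t) (hα : 0 < α) (hy : t ≤ y) :
    paretoMeasure t α (Ioi y) = ENNReal.ofReal (t ^ α * y ^ (-α)) := by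
  have hy0 : 0 < y := ht.trans_le hy
  rw [paretoMeasure_eq_withDensity_restrict, withDensity_apply _ measurableSet_Ioi,
    Measure.restrict_restrict measurableSet_Ioi, Ioi_inter_Ioi, sup_of_le_left hy,
    ← ofReal_integral_eq_lintegral_ofReal]
  · rw [integral_const_mul, integral_Ioi_rpow_of_lt (by linarith) hy0]
    congr 1
    rw [show -(α + 1) + 1 = -α by ring]
    field_simp
  · exact (integrableOn_Ioi_rpow_of_lt (by linarith) hy0).const_mul _
  · filter_upwards [ae_restrict_mem measurableSet_Ioi] with x hx
    have : 0 < x := hy0.trans hx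
    positivity

lemma cond_paretoMeasure_Ioi {t α y : ℝ} (ht : 0 < t) (hα : 0 < α) (hy : t ≤ y) :
    (paretoMeasure t α)[|Ioi y] = paretoMeasure y α := by
  have hy0 : 0 < y := ht.trans_le hy
  rw [ProbabilityTheory.cond, paretoMeasure_Ioi ht hα hy, paretoMeasure_eq_withDensity_restrict,
    restrict_withDensity measurableSet_Ioi, Measure.restrict_restrict measurableSet_Ioi,
    Ioi_inter_Ioi, sup_of_le_left hy, paretoMeasure_eq_withDensity_restrict,
    ← withDensity_smul _ (by fun_prop)]
  congr 1
  ext x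
  simp only [Pi.smul_apply, smul_eq_mul]
  rw [← ENNReal.ofReal_inv_of_pos (by positivity), ← ENNReal.ofReal_mul (by positivity),
    Real.rpow_neg hy0.le]
  congr 1
  field_simp

section Truncated

variable {α y : ℝ}

lemma one_sub_rpow_neg_pos (hα : 0 < α) (hy : 1 < y) : 0 < 1 - y ^ (-α) :=
  sub_pos.2 (Real.rpow_lt_one_of_one_lt_of_neg hy (neg_neg_of_pos hα))

lemma paretoMeasure_one_Iio (hα : 0 < α) (hy : 1 ≤ y) :
    paretoMeasure 1 α (Iio y) = ENNReal.ofReal (1 - y ^ (-α)) := by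
  have := isProbabilityMeasure_paretoMeasure one_pos hα
  rw [measure_congr (Iio_ae_eq_Iic (μ := paretoMeasure 1 α) (a := y)), ← compl_Ioi,
    prob_compl_eq_one_sub measurableSet_Ioi, paretoMeasure_Ioi one_pos hα hy, Real.one_rpow,
    one_mul, ENNReal.ofReal_sub _ (by positivity), ENNReal.ofReal_one]

/-- The Pareto law with shape `α` conditioned to stay below `y`: the law of each of the summands of
the trimmed sum when the pivot is `y`. -/
def below (α y : ℝ) : Measure ℝ := (paretoMeasure 1 α)[|Iio y]

lemma isProbabilityMeasure_below (hα : 0 < α) (hy : 1 < y) :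
    IsProbabilityMeasure (below α y) := by
  have := isProbabilityMeasure_paretoMeasure one_pos hα
  refine cond_isProbabilityMeasure ?_
  rw [paretoMeasure_one_Iio hα hy.le]
  simpa using one_sub_rpow_neg_pos hα hy

lemma ae_below_mem_Ioo (α y : ℝ) : ∀ᵐ x ∂(below α y), x ∈ Ioo 1 y := by
  have hupper : ∀ᵐ x ∂(below α y), x ∈ Iio y := ae_cond_mem measurableSet_Iio
  filter_upwards [cond_absolutelyContinuous (ae_paretoMeasure_mem_Ioi 1 α), hupper]
    with x h1 hy using ⟨h1, hy⟩

lemma memLp_below (hα : 0 < α) (hy : 1 < y) : MemLp id 2 (below α y) := by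
  have := isProbabilityMeasure_below hα hy
  refine MemLp.of_bound (by fun_prop) y ?_
  filter_upwards [ae_below_mem_Ioo α y] with x hx
  rw [id, Real.norm_of_nonneg (by linarith [hx.1])]
  exact hx.2.le

lemma integral_below (hα : 0 < α) (hy : 1 < y) (g : ℝ → ℝ) :
    ∫ x, g x ∂(below α y) =
      (1 - y ^ (-α))⁻¹ * ∫ x in (1 : ℝ)..y, α * x ^ (-(α + 1)) * g x := by
  rw [below, ProbabilityTheory.cond, paretoMeasure_one_Iio hα hy.le, integral_smul_measure,
    ENNReal.toReal_inv, ENNReal.toReal_ofReal (one_sub_rpow_neg_pos hα hy).le, smul_eq_mul,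
    paretoMeasure_eq_withDensity_restrict, restrict_withDensity measurableSet_Iio,
    Measure.restrict_restrict measurableSet_Iio, Iio_inter_Ioi,
    integral_withDensity_eq_integral_toReal_smul (by fun_prop)
      (ae_of_all _ fun _ => ENNReal.ofReal_lt_top),
    intervalIntegral.integral_of_le hy.le, integral_Ioc_eq_integral_Ioo]
  congr 1
  refine setIntegral_congr_fun measurableSet_Ioo fun x hx => ?_
  have hx0 : 0 < x := one_pos.trans hx.1
  simp only [Real.one_rpow, mul_one, smul_eq_mul]
  rw [ENNReal.toReal_ofReal (by positivity)]

lemma integral_pow_below (hα : 0 < α) (hy : 1 < y) (d : ℕ) :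
    ∫ x, x ^ d ∂(below α y) =
      (1 - y ^ (-α))⁻¹ * (α * ∫ x in (1 : ℝ)..y, x ^ ((d : ℝ) - (α + 1))) := by
  rw [integral_below hα hy]
  congr 1
  rw [← intervalIntegral.integral_const_mul]
  refine intervalIntegral.integral_congr (E := ℝ) fun x hx => ?_
  rw [uIcc_of_le hy.le] at hx
  have hx0 : 0 < x := one_pos.trans_le hx.1
  rw [show (d : ℝ) - (α + 1) = -(α + 1) + d by ring, Real.rpow_add hx0, Real.rpow_natCast]
  ring

lemma integral_one_rpow {s : ℝ} (hs : s ≠ -1) (hy : 0 < y) :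
    ∫ x in (1 : ℝ)..y, x ^ s = (y ^ (s + 1) - 1) / (s + 1) := by
  rw [integral_rpow (Or.inr ⟨hs, notMem_uIcc_of_lt one_pos hy⟩), Real.one_rpow]

lemma integral_one_rpow_neg_one (hy : 0 < y) : ∫ x in (1 : ℝ)..y, x ^ (-1 : ℝ) = Real.log y := by
  simp only [Real.rpow_neg_one]
  rw [integral_inv_of_pos one_pos hy, div_one]

lemma integral_id_below (hα : 0 < α) (hy : 1 < y) :
    ∫ x, x ∂(below α y) = condMean 1 0 α y := by
  have hy0 : 0 < y := one_pos.trans hy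
  have hw := one_sub_rpow_neg_pos hα hy
  have h := integral_pow_below hα hy 1
  simp only [pow_one, Nat.cast_one] at h
  rw [h, condMean]
  split_ifs with h1
  · subst h1
    rw [show (1 : ℝ) - (1 + 1) = -1 by norm_num, integral_one_rpow_neg_one hy0]
    simp
  · have h2 : 1 - α ≠ 0 := sub_ne_zero.2 (Ne.symm h1)
    have h3 : α - 1 ≠ 0 := sub_ne_zero.2 h1
    rw [integral_one_rpow (fun hc => h1 (by linarith)) hy0,
      show 1 - (α + 1) + 1 = 1 - α by ring, show 1 - 1 / α = (α - 1) / α by field_simp]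
    push_cast
    field_simp
    ring

lemma variance_below_eq_sub (hα : 0 < α) (hy : 1 < y) :
    variance id (below α y) = (1 - y ^ (-α))⁻¹ * (α * ∫ x in (1 : ℝ)..y, x ^ (1 - α)) -
      condMean 1 0 α y ^ 2 := by
  have := isProbabilityMeasure_below hα hy
  rw [variance_eq_sub (memLp_below hα hy)]
  simp only [Pi.pow_apply, id]
  rw [integral_pow_below hα hy 2, integral_id_below hα hy,
    show ((2 : ℕ) : ℝ) - (α + 1) = 1 - α by push_cast; ring]

lemma variance_below_one (hy : 1 < y) : variance id (below 1 y) = condVar 1 0 1 y := by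
  have hy1 : y - 1 ≠ 0 := by linarith
  rw [variance_below_eq_sub one_pos hy, condVar, if_pos rfl, condMean, if_pos rfl, sub_self]
  simp only [Real.rpow_zero, intervalIntegral.integral_const, smul_eq_mul, Real.rpow_neg_one]
  rw [show 1 - y⁻¹ = (y - 1) / y by field_simp]
  push_cast
  field_simp
  ring

lemma variance_below_two (hy : 1 < y) : variance id (below 2 y) = condVar 1 0 2 y := by
  have hy0 : 0 < y := one_pos.trans hy
  have hy1 : y - 1 ≠ 0 := by linarith
  have hy2 : y + 1 ≠ 0 := by linarith
  rw [variance_below_eq_sub two_pos hy, condVar, if_neg (by norm_num), if_pos rfl, condMean,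
    if_neg (by norm_num), show (1 : ℝ) - 2 = -1 by norm_num, integral_one_rpow_neg_one hy0,
    Real.rpow_neg_one, show y ^ (-2 : ℝ) = (y ^ 2)⁻¹ by rw [Real.rpow_neg hy0.le]; norm_num,
    show 1 - (y ^ 2)⁻¹ = (y - 1) * (y + 1) / y ^ 2 by field_simp; ring,
    show y ^ 2 - 1 = (y - 1) * (y + 1) by ring]
  push_cast
  field_simp
  ring

lemma variance_below_of_ne (hα : 0 < α) (hα1 : α ≠ 1) (hα2 : α ≠ 2) (hy : 1 < y) :
    variance id (below α y) = condVar 1 0 α y := by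
  have hw := one_sub_rpow_neg_pos hα hy
  have h1 : α - 1 ≠ 0 := sub_ne_zero.2 hα1
  have h2 : α - 2 ≠ 0 := sub_ne_zero.2 hα2
  have h3 : 2 - α ≠ 0 := sub_ne_zero.2 (Ne.symm hα2)
  rw [variance_below_eq_sub hα hy, condVar, if_neg hα1, if_neg hα2, condMean, if_neg hα1,
    integral_one_rpow (fun hc => hα2 (by linarith)) (one_pos.trans hy),
    show 1 - α + 1 = 2 - α by ring, show 1 - 1 / α = (α - 1) / α by field_simp,
    show 1 - 2 / α = (α - 2) / α by field_simp]
  push_cast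
  field_simp
  ring

lemma variance_below (hα : 0 < α) (hy : 1 < y) : variance id (below α y) = condVar 1 0 α y := by
  rcases eq_or_ne α 1 with rfl | h1
  · exact variance_below_one hy
  rcases eq_or_ne α 2 with rfl | h2
  · exact variance_below_two hy
  exact variance_below_of_ne hα h1 h2 hy

lemma condMean_eq_mul (n k : ℕ) (α y : ℝ) :
    condMean n k α y = ((n : ℝ) - k) * condMean 1 0 α y := by
  simp only [condMean]; push_cast; ring

lemma condVar_eq_mul (n k : ℕ) (α y : ℝ) :
    condVar n k α y = ((n : ℝ) - k) * condVar 1 0 α y := by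
  simp only [condVar]; push_cast; split_ifs <;> ring

lemma condVar_one_pos (hα : 0 < α) (hy : 1 < y) : 0 < condVar 1 0 α y := by
  have := isProbabilityMeasure_below hα hy
  have := isProbabilityMeasure_paretoMeasure one_pos hα
  have hac : below α y ≪ paretoMeasure 1 α := cond_absolutelyContinuous
  rw [← variance_below hα hy]
  refine (variance_nonneg _ _).lt_of_ne fun h => ?_
  have hconst := ae_eq_integral_of_variance_eq_zero (memLp_below hα hy) h.symm
  have hne : ∀ᵐ x ∂(below α y), x ≠ (below α y)[id] :=
    hac (compl_mem_ae_iff.2 (measure_singleton _))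
  obtain ⟨x, hx, hx'⟩ := (hconst.and hne).exists
  exact hx' hx

end Truncated

/-! ### Moments of sums and densities of convolutions -/

section SumLaw

variable {ν : Measure ℝ} [IsProbabilityMeasure ν]

lemma memLp_eval_pi {ι : Type*} [Fintype ι] (h : MemLp id 2 ν) (i : ι) :
    MemLp (fun x : ι → ℝ => x i) 2 (Measure.pi fun _ : ι => ν) :=
  h.comp_measurePreserving (measurePreserving_eval (fun _ : ι => ν) i)

lemma memLp_sumLaw (N : ℕ) (h : MemLp id 2 ν) : MemLp id 2 (sumLaw N ν) := by
  rw [sumLaw, memLp_map_measure_iff (by fun_prop) (by fun_prop)]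
  exact memLp_finsetSum (f := fun i (x : Fin N → ℝ) => x i) Finset.univ fun i _ =>
    memLp_eval_pi h i

lemma integral_sumLaw (N : ℕ) (h : MemLp id 2 ν) :
    ∫ x, x ∂(sumLaw N ν) = N * ∫ x, x ∂ν := by
  have heval : ∀ i : Fin N, ∫ x, x i ∂(Measure.pi fun _ : Fin N => ν) = ∫ x, x ∂ν := fun i =>
    integral_comp_eval (μ := fun _ : Fin N => ν) (f := fun x => x) (by fun_prop)
  rw [sumLaw, integral_map (by fun_prop) (by fun_prop), integral_finsetSum _ fun i _ =>
    (memLp_eval_pi h i).integrable (by norm_num)]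
  simp [heval]

lemma variance_sumLaw (N : ℕ) (h : MemLp id 2 ν) :
    variance id (sumLaw N ν) = N * variance id ν := by
  have hsum := variance_sum_pi (μ := fun _ : Fin N => ν) (X := fun _ => id) (fun _ => h)
  simp only [Finset.sum_const, Finset.card_univ, Fintype.card_fin, nsmul_eq_mul] at hsum
  rw [sumLaw, variance_map (by fun_prop) (by fun_prop), ← hsum]
  congr 1
  ext x
  simp

variable (ν)

lemma sumLaw_zero : sumLaw 0 ν = Measure.dirac 0 := by
  refine Measure.ext_of_charFun ?_
  ext t
  simp [charFun_sumLaw, charFun_dirac]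

lemma sumLaw_one : sumLaw 1 ν = ν := by
  refine Measure.ext_of_charFun ?_
  ext t
  rw [charFun_sumLaw, pow_one]

lemma sumLaw_succ (N : ℕ) : sumLaw (N + 1) ν = sumLaw N ν ∗ ν := by
  refine Measure.ext_of_charFun ?_
  ext t
  rw [charFun_conv, charFun_sumLaw, charFun_sumLaw, pow_succ]

end SumLaw

section Conv

variable {f g : ℝ → ℝ}

lemma conv_apply (f g : ℝ → ℝ) (x : ℝ) : conv f g x = ∫ t, f t * g (x - t) := rfl

lemma conv_nonneg (hf : 0 ≤ f) (hg : 0 ≤ g) : 0 ≤ conv f g := fun x => by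
  rw [conv_apply]
  exact integral_nonneg fun t => mul_nonneg (hf t) (hg _)

lemma integrable_conv (hf : Integrable f) (hg : Integrable g) : Integrable (conv f g) :=
  hf.integrable_convolution (ContinuousLinearMap.mul ℝ ℝ) hg

lemma withDensity_conv_withDensity (hf : Integrable f) (hg : Integrable g) (hf0 : 0 ≤ f)
    (hg0 : 0 ≤ g) :
    (volume.withDensity fun x => ENNReal.ofReal (f x)) ∗
        (volume.withDensity fun x => ENNReal.ofReal (g x)) =
      volume.withDensity fun x => ENNReal.ofReal (conv f g x) := by
  rw [conv_withDensity_eq_mlconvolution₀ hf.aemeasurable.ennreal_ofReal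
    hg.aemeasurable.ennreal_ofReal]
  refine withDensity_congr_ae ?_
  filter_upwards [hf.ae_convolution_exists (ContinuousLinearMap.mul ℝ ℝ) hg] with x hx
  have hint : Integrable fun t => f t * g (x - t) := hx
  rw [lconvolution_def, conv_apply, ofReal_integral_eq_lintegral_ofReal hint
    (ae_of_all _ fun t => mul_nonneg (hf0 t) (hg0 _))]
  refine lintegral_congr fun t => ?_
  rw [ENNReal.ofReal_mul (hf0 t), neg_add_eq_sub]

lemma convPow_nonneg (hf0 : 0 ≤ f) : ∀ N : ℕ, 0 ≤ convPow f N
  | 0 => le_rfl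
  | 1 => hf0
  | N + 2 => conv_nonneg (convPow_nonneg hf0 (N + 1)) hf0

lemma integrable_convPow (hf : Integrable f) : ∀ N : ℕ, Integrable (convPow f N)
  | 0 => integrable_zero _ _ _
  | 1 => hf
  | N + 2 => integrable_conv (integrable_convPow hf (N + 1)) hf

lemma sumLaw_withDensity (hf : Integrable f) (hf0 : 0 ≤ f)
    [IsProbabilityMeasure (volume.withDensity fun x => ENNReal.ofReal (f x))] (N : ℕ) :
    sumLaw (N + 1) (volume.withDensity fun x => ENNReal.ofReal (f x)) =
      volume.withDensity fun x => ENNReal.ofReal (convPow f (N + 1) x) := by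
  induction N with
  | zero => exact sumLaw_one _
  | succ N ih =>
    rw [sumLaw_succ, ih, withDensity_conv_withDensity (integrable_convPow hf _) hf
      (convPow_nonneg hf0 _) hf0, convPow]

lemma withDensity_real_Ioc (hf : Integrable f) (hf0 : 0 ≤ f) {a b : ℝ} (hab : a ≤ b) :
    (volume.withDensity fun x => ENNReal.ofReal (f x)).real (Ioc a b) = ∫ v in a..b, f v := by
  rw [measureReal_def, withDensity_apply _ measurableSet_Ioc,
    ← ofReal_integral_eq_lintegral_ofReal hf.integrableOn (ae_of_all _ hf0),
    ENNReal.toReal_ofReal (integral_nonneg hf0), intervalIntegral.integral_of_le hab]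

end Conv

section UpperBlock

variable {α y : ℝ}

lemma upperPDF_nonneg (hα : 0 ≤ α) (hy : 0 ≤ y) : 0 ≤ upperPDF α y :=
  fun x => paretoPDFReal_nonneg hy hα x

lemma integrable_upperPDF (hα : 0 < α) (hy : 0 < y) : Integrable (upperPDF α y) := by
  refine ⟨(measurable_paretoPDFReal y α).aestronglyMeasurable, ?_⟩
  rw [hasFiniteIntegral_iff_ofReal (ae_of_all _ (upperPDF_nonneg hα.le hy.le))]
  exact (lintegral_paretoPDF_eq_one hy hα).trans_lt ENNReal.one_lt_top

lemma sumLaw_paretoMeasure (hα : 0 < α) (hy : 0 < y) (N : ℕ) :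
    sumLaw (N + 1) (paretoMeasure y α) =
      volume.withDensity fun x => ENNReal.ofReal (convPow (upperPDF α y) (N + 1) x) := by
  have : IsProbabilityMeasure (volume.withDensity fun x => ENNReal.ofReal (upperPDF α y x)) :=
    isProbabilityMeasure_paretoMeasure hy hα
  exact sumLaw_withDensity (integrable_upperPDF hα hy) (upperPDF_nonneg hα.le hy.le) N

lemma condNormal_eq_withDensity {n k : ℕ} (hv : 0 < condVar n k α y) :
    condNormal n k α y = volume.withDensity fun x => ENNReal.ofReal
      (gaussianPDFReal (condMean n k α y) (condVar n k α y).toNNReal x) :=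
  gaussianReal_of_var_ne_zero _ (by simpa using hv)

lemma gaussianPDFReal_eq_inv_sqrt_mul_standard {v : ℝ} (hv : 0 < v) (m x : ℝ) :
    gaussianPDFReal m v.toNNReal x = 1 / √v * gaussianPDFReal 0 1 ((x - m) / √v) := by
  have hexp : -((x - m) ^ 2 / v) / 2 = -(x - m) ^ 2 / (2 * v) := by field_simp
  simp only [gaussianPDFReal, NNReal.coe_one, mul_one, sub_zero, Real.coe_toNNReal _ hv.le,
    div_pow, Real.sq_sqrt hv.le, hexp]
  rw [Real.sqrt_mul (by positivity) v, mul_inv]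
  ring

lemma normexInner_one {n : ℕ} {s : ℝ} (hv : 0 < condVar n 1 α y) (hs : 0 ≤ s) :
    normexInner n 1 α y s = (condNormal n 1 α y).real (Ioc 0 s) := by
  rw [normexInner, if_pos rfl, condNormal_eq_withDensity hv, withDensity_real_Ioc
    (integrable_gaussianPDFReal _ _) (fun _ => gaussianPDFReal_nonneg _ _ _) hs,
    ← intervalIntegral.integral_const_mul]
  simp only [gaussianPDFReal_eq_inv_sqrt_mul_standard hv, condStd]

lemma normexInner_add_two {n r : ℕ} {s : ℝ} (hα : 0 < α) (hy : 0 < y)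
    (hv : 0 < condVar n (r + 2) α y) (hs : 0 ≤ s) :
    normexInner n (r + 2) α y s =
      (condNormal n (r + 2) α y ∗ sumLaw (r + 1) (paretoMeasure y α)).real (Ioc 0 s) := by
  have hg := integrable_gaussianPDFReal (condMean n (r + 2) α y) (condVar n (r + 2) α y).toNNReal
  have hg0 : 0 ≤ gaussianPDFReal (condMean n (r + 2) α y) (condVar n (r + 2) α y).toNNReal :=
    fun _ => gaussianPDFReal_nonneg _ _ _
  have hu := integrable_convPow (integrable_upperPDF hα hy) (r + 1)
  have hu0 := convPow_nonneg (upperPDF_nonneg hα.le hy.le) (r + 1)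
  rw [normexInner, if_neg (by omega), sumLaw_paretoMeasure hα hy, condNormal_eq_withDensity hv,
    withDensity_conv_withDensity hg hu hg0 hu0,
    withDensity_real_Ioc (integrable_conv hg hu) (conv_nonneg hg0 hu0) hs]
  rfl

lemma normexInner_eq {n r : ℕ} {s : ℝ} (hα : 0 < α) (hy : 0 < y)
    (hv : 0 < condVar n (r + 1) α y) (hs : 0 ≤ s) :
    normexInner n (r + 1) α y s =
      (condNormal n (r + 1) α y ∗ sumLaw r (paretoMeasure y α)).real (Ioc 0 s) := by
  have := isProbabilityMeasure_paretoMeasure hy hα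
  have : SFinite (condNormal n (r + 1) α y) := by rw [condNormal]; infer_instance
  rcases r with _ | r
  · rw [sumLaw_zero, Measure.conv_dirac_zero, normexInner_one hv hs]
  · exact normexInner_add_two hα hy hv hs

end UpperBlock

/-! ### Disintegration of the sample along the pivot -/

section Measurability

variable {n : ℕ}

lemma measurable_comp_sort (j : Fin n) :
    Measurable fun x : Fin n → ℝ => x (Tuple.sort x j) := by
  refine measurable_of_Iic fun t => ?_
  have hpre : (fun x : Fin n → ℝ => x (Tuple.sort x j)) ⁻¹' Iic t =
      {x | (j : ℕ) < ∑ i, if x i ≤ t then 1 else 0} := by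
    ext x
    have h := Tuple.lt_card_le_iff_apply_le_of_monotone (f := x ∘ Tuple.sort x) (a := t) (j := j)
      (Tuple.monotone_sort x)
    rw [Finset.card_filter] at h
    simp only [Function.comp] at h
    rw [Equiv.sum_comp (Tuple.sort x) fun i => if x i ≤ t then 1 else 0] at h
    exact h.symm
  rw [hpre]
  refine measurableSet_lt measurable_const (Finset.measurable_sum _ fun i _ => ?_)
  exact Measurable.ite (measurableSet_le (measurable_pi_apply i) measurable_const)
    measurable_const measurable_const

lemma measurable_orderStat (i : ℕ) : Measurable fun x : Fin n → ℝ => orderStat x i := by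
  by_cases h : 1 ≤ i ∧ i ≤ n
  · simp only [orderStat, dif_pos h]
    exact measurable_comp_sort _
  · simp only [orderStat, dif_neg h]
    exact measurable_const

lemma measurable_pivot (k : ℕ) : Measurable fun x : Fin n → ℝ => pivot x k :=
  measurable_orderStat _

lemma measurable_trimmedSum (k : ℕ) : Measurable fun x : Fin n → ℝ => trimmedSum x k :=
  Finset.measurable_sum _ fun _ _ => measurable_orderStat _

lemma measurable_topSum (k : ℕ) : Measurable fun x : Fin n → ℝ => topSum x k :=
  Finset.measurable_sum _ fun _ _ => measurable_orderStat _

end Measurability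

section MeasurableFamilies

variable {β : Type*} [MeasurableSpace β]

lemma measurable_pi_const {ι γ : Type*} [Fintype ι] [MeasurableSpace γ] {κ : β → Measure γ}
    [∀ y, IsProbabilityMeasure (κ y)] (hκ : Measurable κ) :
    Measurable fun y => Measure.pi fun _ : ι => κ y := by
  refine Measurable.measure_of_isPiSystem_of_isProbabilityMeasure generateFrom_pi.symm
    isPiSystem_pi ?_
  rintro _ ⟨s, hs, rfl⟩
  simp only [Measure.pi_pi]
  exact Finset.measurable_prod _ fun i _ => (Measure.measurable_coe (hs i (mem_univ i))).comp hκ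

lemma measurable_sumLaw {N : ℕ} {κ : β → Measure ℝ} [∀ y, IsProbabilityMeasure (κ y)]
    (hκ : Measurable κ) : Measurable fun y => sumLaw N (κ y) :=
  (Measure.measurable_map _ (by fun_prop)).comp (measurable_pi_const hκ)

lemma measurable_cond_prodMk_preimage {γ : Type*} [MeasurableSpace γ] (μ : Measure γ) [SFinite μ]
    {S : Set (β × γ)} (hS : MeasurableSet S) : Measurable fun y => μ[|Prod.mk y ⁻¹' S] := by
  refine Measure.measurable_of_measurable_coe _ fun s hs => ?_
  simp only [cond_apply (measurable_prodMk_left hS)]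
  exact (measurable_measure_prodMk_left hS).inv.mul
    (measurable_measure_prodMk_left (hS.inter (measurable_snd hs)))

end MeasurableFamilies

section Kernels

variable {α : ℝ}

/-- The law of the entries below the pivot `y`, extended by a point mass for `y ≤ 1` so that it is
a probability measure for every `y`. -/
def lowerLaw (α y : ℝ) : Measure ℝ := if 1 < y then below α y else Measure.dirac 0

/-- The law of the entries above the pivot `y`, extended by a point mass for `y ≤ 1` so that it is
a probability measure for every `y`. -/
def upperLaw (α y : ℝ) : Measure ℝ := if 1 < y then paretoMeasure y α else Measure.dirac 0

lemma lowerLaw_of_one_lt {y : ℝ} (hy : 1 < y) : lowerLaw α y = below α y := if_pos hy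

lemma upperLaw_of_one_lt {y : ℝ} (hy : 1 < y) : upperLaw α y = paretoMeasure y α := if_pos hy

lemma isProbabilityMeasure_lowerLaw (hα : 0 < α) (y : ℝ) :
    IsProbabilityMeasure (lowerLaw α y) := by
  by_cases hy : 1 < y
  · rw [lowerLaw_of_one_lt hy]; exact isProbabilityMeasure_below hα hy
  · rw [lowerLaw, if_neg hy]; infer_instance

lemma isProbabilityMeasure_upperLaw (hα : 0 < α) (y : ℝ) :
    IsProbabilityMeasure (upperLaw α y) := by
  by_cases hy : 1 < y
  · rw [upperLaw_of_one_lt hy]; exact isProbabilityMeasure_paretoMeasure (by linarith) hα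
  · rw [upperLaw, if_neg hy]; infer_instance

lemma measurable_lowerLaw (hα : 0 < α) : Measurable (lowerLaw α) := by
  have := isProbabilityMeasure_paretoMeasure one_pos hα
  exact Measurable.ite measurableSet_Ioi (measurable_cond_prodMk_preimage
    (paretoMeasure 1 α) (S := {p | p.2 < p.1}) (measurableSet_lt measurable_snd measurable_fst))
    measurable_const

lemma measurable_upperLaw (hα : 0 < α) : Measurable (upperLaw α) := by
  have := isProbabilityMeasure_paretoMeasure one_pos hα
  have hcond : upperLaw α = fun y =>
      if 1 < y then (paretoMeasure 1 α)[|Ioi y] else Measure.dirac 0 := by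
    ext1 y
    by_cases hy : 1 < y
    · rw [upperLaw_of_one_lt hy, if_pos hy, cond_paretoMeasure_Ioi one_pos hα hy.le]
    · rw [upperLaw, if_neg hy, if_neg hy]
  rw [hcond]
  exact Measurable.ite measurableSet_Ioi (measurable_cond_prodMk_preimage
    (paretoMeasure 1 α) (S := {p | p.1 < p.2}) (measurableSet_lt measurable_fst measurable_snd))
    measurable_const

/-- The conditional law of the sum of the `m` entries below the pivot, given the pivot. -/
def lowerKernel (hα : 0 < α) (m : ℕ) : Kernel ℝ ℝ where
  toFun y := sumLaw m (lowerLaw α y)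
  measurable' :=
    have := isProbabilityMeasure_lowerLaw hα
    measurable_sumLaw (measurable_lowerLaw hα)

/-- The conditional law of the sum of the `r` entries above the pivot, given the pivot. -/
def upperKernel (hα : 0 < α) (r : ℕ) : Kernel ℝ ℝ where
  toFun y := sumLaw r (upperLaw α y)
  measurable' :=
    have := isProbabilityMeasure_upperLaw hα
    measurable_sumLaw (measurable_upperLaw hα)

lemma lowerKernel_apply (hα : 0 < α) (m : ℕ) (y : ℝ) :
    lowerKernel hα m y = sumLaw m (lowerLaw α y) := rfl

lemma upperKernel_apply (hα : 0 < α) (r : ℕ) (y : ℝ) :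
    upperKernel hα r y = sumLaw r (upperLaw α y) := rfl

lemma lowerKernel_of_one_lt (hα : 0 < α) (m : ℕ) {y : ℝ} (hy : 1 < y) :
    lowerKernel hα m y = sumLaw m (below α y) := by
  rw [lowerKernel_apply, lowerLaw_of_one_lt hy]

lemma upperKernel_of_one_lt (hα : 0 < α) (r : ℕ) {y : ℝ} (hy : 1 < y) :
    upperKernel hα r y = sumLaw r (paretoMeasure y α) := by
  rw [upperKernel_apply, upperLaw_of_one_lt hy]

instance (hα : 0 < α) (m : ℕ) : IsMarkovKernel (lowerKernel hα m) where
  isProbabilityMeasure y := by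
    have := isProbabilityMeasure_lowerLaw hα y
    rw [lowerKernel_apply]; infer_instance

instance (hα : 0 < α) (r : ℕ) : IsMarkovKernel (upperKernel hα r) where
  isProbabilityMeasure y := by
    have := isProbabilityMeasure_upperLaw hα y
    rw [upperKernel_apply]; infer_instance

end Kernels

section PivotLaw

variable {α : ℝ}

lemma measurable_orderStatPDF (n i : ℕ) (α : ℝ) : Measurable (orderStatPDF n i α) := by
  unfold orderStatPDF
  fun_prop

lemma orderStatPDF_eq (m r : ℕ) (α y : ℝ) :
    orderStatPDF (m + 1 + r) (m + 1) α y =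
      ((m + 1 + r).factorial : ℝ) / (m.factorial * r.factorial) * α * (1 - y ^ (-α)) ^ m *
        y ^ (-(α * (r + 1)) - 1) := by
  rw [orderStatPDF, show m + 1 + r - (m + 1) = r by omega, Nat.add_sub_cancel]
  congr 2
  push_cast
  ring

lemma orderStatPDF_pos (hα : 0 < α) (m r : ℕ) {y : ℝ} (hy : 1 < y) :
    0 < orderStatPDF (m + 1 + r) (m + 1) α y := by
  have := one_sub_rpow_neg_pos hα hy
  have : 0 < y := one_pos.trans hy
  rw [orderStatPDF_eq]
  positivity

/-- The law with density `f_{(m+1)}`, which is that of the pivot with `m` entries below it and `r`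
above it. -/
def pivotLaw (α : ℝ) (m r : ℕ) : Measure ℝ :=
  (volume.restrict (Ioi 1)).withDensity
    (fun y => ENNReal.ofReal (orderStatPDF (m + 1 + r) (m + 1) α y))

instance (α : ℝ) (m r : ℕ) : SFinite (pivotLaw α m r) := by
  rw [pivotLaw]; infer_instance

lemma lintegral_pivotLaw (α : ℝ) (m r : ℕ) (g : ℝ → ENNReal) :
    ∫⁻ y, g y ∂(pivotLaw α m r) =
      ∫⁻ y in Ioi 1, ENNReal.ofReal (orderStatPDF (m + 1 + r) (m + 1) α y) * g y := by
  rw [pivotLaw, lintegral_withDensity_eq_lintegral_mul_non_measurable _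
    (measurable_orderStatPDF _ _ _).ennreal_ofReal (ae_of_all _ fun _ => ENNReal.ofReal_lt_top)]
  rfl

lemma factorial_mul_orderStatPDF (hα : 0 < α) (m r : ℕ) {y : ℝ} (hy : 1 < y) :
    ((m.factorial * r.factorial : ℕ) : ENNReal) *
        ENNReal.ofReal (orderStatPDF (m + 1 + r) (m + 1) α y) =
      ((m + 1 + r).factorial : ℕ) * (ENNReal.ofReal (α * 1 ^ α * y ^ (-(α + 1))) *
        (paretoMeasure 1 α (Iio y) ^ m * paretoMeasure 1 α (Ioi y) ^ r)) := by
  have hw := one_sub_rpow_neg_pos hα hy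
  have hy0 : 0 < y := one_pos.trans hy
  have hpow : y ^ (-(α * (r + 1)) - 1) = y ^ (-(α + 1)) * (y ^ (-α)) ^ r := by
    rw [← Real.rpow_natCast, ← Real.rpow_mul hy0.le, ← Real.rpow_add hy0]
    congr 1
    ring
  rw [paretoMeasure_one_Iio hα hy.le, paretoMeasure_Ioi one_pos hα hy.le, Real.one_rpow, one_mul,
    mul_one, ← ENNReal.ofReal_pow hw.le, ← ENNReal.ofReal_pow (by positivity),
    ← ENNReal.ofReal_mul (by positivity), ← ENNReal.ofReal_mul (by positivity),
    ← ENNReal.ofReal_natCast, ← ENNReal.ofReal_natCast, ← ENNReal.ofReal_mul (by positivity),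
    ← ENNReal.ofReal_mul (by positivity), orderStatPDF_eq, hpow]
  congr 1
  push_cast
  field_simp

lemma factorial_mul_lintegral_pivotLaw (hα : 0 < α) (m r : ℕ) (g : ℝ → ENNReal) :
    ((m.factorial * r.factorial : ℕ) : ENNReal) * ∫⁻ y, g y ∂(pivotLaw α m r) =
      (m + 1 + r).factorial * ∫⁻ y, paretoMeasure 1 α (Iio y) ^ m *
        paretoMeasure 1 α (Ioi y) ^ r * g y ∂(paretoMeasure 1 α) := by
  rw [lintegral_pivotLaw, lintegral_paretoMeasure,
    ← lintegral_const_mul' _ _ (ENNReal.natCast_ne_top _),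
    ← lintegral_const_mul' _ _ (ENNReal.natCast_ne_top _)]
  refine setLIntegral_congr_fun measurableSet_Ioi fun y hy => ?_
  simp only [← mul_assoc]
  rw [factorial_mul_orderStatPDF hα m r hy]
  simp only [mul_assoc]

theorem map_pivot_trimmedSum_topSum (hα : 0 < α) (m r : ℕ) :
    (Measure.pi fun _ : Fin (m + 1 + r) => paretoMeasure 1 α).map
      (fun x => (pivot x (r + 1), trimmedSum x (r + 1), topSum x (r + 1))) =
      pivotLaw α m r ⊗ₘ (lowerKernel hα m ×ₖ upperKernel hα r) := by
  have := isProbabilityMeasure_paretoMeasure one_pos hα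
  have hmid : (mid m r : ℕ) = m := rfl
  have hfact : ((m.factorial * r.factorial : ℕ) : ENNReal) ≠ 0 := by
    exact_mod_cast (Nat.mul_pos m.factorial_pos r.factorial_pos).ne'
  refine Measure.ext_of_lintegral _ fun F hF => ?_
  rw [lintegral_map hF
    ((measurable_pivot _).prodMk ((measurable_trimmedSum _).prodMk (measurable_topSum _))),
    Measure.lintegral_compProd hF]
  refine (ENNReal.mul_right_inj hfact (ENNReal.natCast_ne_top _)).1 ?_
  have hsorted := lintegral_pivot_trimmedSum_topSum (paretoMeasure 1 α) (p := mid m r)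
    (k := r + 1) (by omega) hF
  rw [lintegral_indicator_blockSet _ hF, hmid, Nat.add_sub_cancel] at hsorted
  rw [hsorted, factorial_mul_lintegral_pivotLaw hα]
  congr 1
  refine lintegral_congr_ae ?_
  filter_upwards [ae_paretoMeasure_mem_Ioi 1 α] with y hy
  rw [Kernel.prod_apply, lowerKernel_of_one_lt hα m hy, upperKernel_of_one_lt hα r hy, below,
    cond_paretoMeasure_Ioi one_pos hα (mem_Ioi.1 hy).le]

lemma map_pivot (hα : 0 < α) (m r : ℕ) :
    (Measure.pi fun _ : Fin (m + 1 + r) => paretoMeasure 1 α).map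
      (fun x => pivot x (r + 1)) = pivotLaw α m r := by
  have h := congrArg Measure.fst (map_pivot_trimmedSum_topSum hα m r)
  rw [Measure.fst_compProd] at h
  rw [← h, Measure.fst, Measure.map_map measurable_fst
    ((measurable_pivot _).prodMk ((measurable_trimmedSum _).prodMk (measurable_topSum _)))]
  rfl

lemma isProbabilityMeasure_pivotLaw (hα : 0 < α) (m r : ℕ) :
    IsProbabilityMeasure (pivotLaw α m r) := by
  have := isProbabilityMeasure_paretoMeasure one_pos hα
  rw [← map_pivot hα]
  exact Measure.isProbabilityMeasure_map (measurable_pivot _).aemeasurable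

lemma ae_of_ae_pivotLaw (hα : 0 < α) {m r : ℕ} {p : ℝ → Prop}
    (h : ∀ᵐ y ∂(pivotLaw α m r), p y) : ∀ᵐ y ∂(volume.restrict (Ioi (1 : ℝ))), p y := by
  refine withDensity_absolutelyContinuous' (f := fun y =>
    ENNReal.ofReal (orderStatPDF (m + 1 + r) (m + 1) α y))
    (measurable_orderStatPDF _ _ _).ennreal_ofReal.aemeasurable ?_ h
  filter_upwards [ae_restrict_mem measurableSet_Ioi] with y hy
  simpa using orderStatPDF_pos hα m r hy

lemma integrableOn_orderStatPDF (hα : 0 < α) (m r : ℕ) :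
    IntegrableOn (orderStatPDF (m + 1 + r) (m + 1) α) (Ioi 1) := by
  have := isProbabilityMeasure_pivotLaw hα m r
  have hpos : ∀ᵐ y ∂(volume.restrict (Ioi (1 : ℝ))),
      0 ≤ orderStatPDF (m + 1 + r) (m + 1) α y := by
    filter_upwards [ae_restrict_mem measurableSet_Ioi] with y hy
    exact (orderStatPDF_pos hα m r hy).le
  have hmass := lintegral_pivotLaw α m r 1
  simp only [Pi.one_apply, lintegral_one, measure_univ, mul_one] at hmass
  refine ⟨(measurable_orderStatPDF _ _ _).aestronglyMeasurable, ?_⟩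
  rw [hasFiniteIntegral_iff_ofReal hpos, ← hmass]
  exact ENNReal.one_lt_top

end PivotLaw

/-! ### Conditional laws given the pivot -/

section CondDistrib

variable {Ω β γ δ : Type*} [MeasurableSpace Ω] [MeasurableSpace β] [MeasurableSpace γ]
  [StandardBorelSpace γ] [Nonempty γ] [MeasurableSpace δ] [StandardBorelSpace δ] [Nonempty δ]
  {P : Measure Ω} [IsFiniteMeasure P] {Y : Ω → β} {Z : Ω → γ}

lemma condDistrib_comp_prodMk (hY : AEMeasurable Y P) (hZ : AEMeasurable Z P) {g : β × γ → δ}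
    (hg : Measurable g) : ∀ᵐ y ∂(P.map Y),
      condDistrib (fun ω => g (Y ω, Z ω)) Y P y = (condDistrib Z Y P y).map fun z => g (y, z) := by
  have : IsMarkovKernel ((Kernel.id ×ₖ condDistrib Z Y P).map g) := Kernel.IsMarkovKernel.map _ hg
  have hpair : Measurable fun p : β × γ => (p.1, g p) := measurable_fst.prodMk hg
  have hmap : ∀ y, ((Kernel.id ×ₖ condDistrib Z Y P).map g) y =
      (condDistrib Z Y P y).map fun z => g (y, z) := fun y => by
    rw [Kernel.map_apply _ hg, Kernel.prod_apply, Kernel.id_apply, Measure.dirac_prod,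
      Measure.map_map hg measurable_prodMk_left]
    rfl
  have hlaw : P.map (fun ω => (Y ω, g (Y ω, Z ω))) =
      P.map Y ⊗ₘ (Kernel.id ×ₖ condDistrib Z Y P).map g := by
    have hcomp : P.map (fun ω => (Y ω, g (Y ω, Z ω))) =
        (P.map Y ⊗ₘ condDistrib Z Y P).map fun p => (p.1, g p) := by
      rw [compProd_map_condDistrib hZ, AEMeasurable.map_map_of_aemeasurable hpair.aemeasurable
        (hY.prodMk hZ)]
      rfl
    rw [hcomp]
    ext s hs
    rw [Measure.map_apply hpair hs, Measure.compProd_apply (hpair hs), Measure.compProd_apply hs]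
    refine lintegral_congr fun y => ?_
    rw [hmap, Measure.map_apply (by fun_prop) (measurable_prodMk_left hs)]
    rfl
  filter_upwards [condDistrib_ae_eq_of_measure_eq_compProd Y
    (hg.comp_aemeasurable (hY.prodMk hZ)) hlaw] with y hy
  exact hy.trans (hmap y)

lemma cdf_map_eq_integral_cdf_condDistrib {P : Measure Ω} [IsProbabilityMeasure P] {S : Ω → ℝ}
    (hY : AEMeasurable Y P) (hS : AEMeasurable S P) (x : ℝ) :
    cdf (P.map S) x = ∫ y, cdf (condDistrib S Y P y) x ∂(P.map Y) := by
  have := Measure.isProbabilityMeasure_map hS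
  simp only [cdf_eq_real, measureReal_def]
  rw [integral_toReal ((condDistrib S Y P).measurable_coe measurableSet_Iic).aemeasurable
    (ae_of_all _ fun _ => measure_lt_top _ _), ← condDistrib_comp_map hY hS,
    Measure.bind_apply measurableSet_Iic (Kernel.aemeasurable _)]

end CondDistrib

section Sample

variable {α : ℝ} {m r : ℕ} {Ω : Type*} [MeasurableSpace Ω] {P : Measure Ω}
  {X : Ω → Fin (m + 1 + r) → ℝ}

lemma map_pivot_sample (hα : 0 < α) (hX : HasLaw X (Measure.pi fun _ => paretoMeasure 1 α) P) :
    P.map (fun ω => pivot (X ω) (r + 1)) = pivotLaw α m r := by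
  rw [← map_pivot hα, ← hX.map_eq, AEMeasurable.map_map_of_aemeasurable
    (measurable_pivot _).aemeasurable hX.aemeasurable]
  rfl

lemma map_pivot_trimmedSum_topSum_sample (hα : 0 < α)
    (hX : HasLaw X (Measure.pi fun _ => paretoMeasure 1 α) P) :
    P.map (fun ω =>
        (pivot (X ω) (r + 1), trimmedSum (X ω) (r + 1), topSum (X ω) (r + 1))) =
      pivotLaw α m r ⊗ₘ (lowerKernel hα m ×ₖ upperKernel hα r) := by
  rw [← map_pivot_trimmedSum_topSum hα, ← hX.map_eq, AEMeasurable.map_map_of_aemeasurable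
    ((measurable_pivot _).prodMk
      ((measurable_trimmedSum _).prodMk (measurable_topSum _))).aemeasurable hX.aemeasurable]
  rfl

variable [IsProbabilityMeasure P]

lemma condDistrib_trimmedSum_topSum (hα : 0 < α)
    (hX : HasLaw X (Measure.pi fun _ => paretoMeasure 1 α) P) :
    ∀ᵐ y ∂(volume.restrict (Ioi (1 : ℝ))),
      condDistrib (fun ω => (trimmedSum (X ω) (r + 1), topSum (X ω) (r + 1)))
        (fun ω => pivot (X ω) (r + 1)) P y =
      (lowerKernel hα m y).prod (upperKernel hα r y) := by
  have h := condDistrib_ae_eq_of_measure_eq_compProd (μ := P) (fun ω => pivot (X ω) (r + 1))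
    (Y := fun ω => (trimmedSum (X ω) (r + 1), topSum (X ω) (r + 1)))
    (((measurable_trimmedSum _).prodMk (measurable_topSum _)).comp_aemeasurable hX.aemeasurable)
    (κ := lowerKernel hα m ×ₖ upperKernel hα r)
    (by rw [map_pivot_trimmedSum_topSum_sample hα hX, map_pivot_sample hα hX])
  rw [map_pivot_sample hα hX] at h
  filter_upwards [ae_of_ae_pivotLaw hα h] with y hy
  rw [hy, Kernel.prod_apply]

lemma condDistrib_comp_pivot_trimmedSum_topSum (hα : 0 < α)
    (hX : HasLaw X (Measure.pi fun _ => paretoMeasure 1 α) P) {δ : Type*} [MeasurableSpace δ]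
    [StandardBorelSpace δ] [Nonempty δ] {g : ℝ × ℝ × ℝ → δ} (hg : Measurable g) :
    ∀ᵐ y ∂(volume.restrict (Ioi (1 : ℝ))),
      condDistrib (fun ω => g (pivot (X ω) (r + 1), trimmedSum (X ω) (r + 1),
        topSum (X ω) (r + 1))) (fun ω => pivot (X ω) (r + 1)) P y =
      ((lowerKernel hα m y).prod (upperKernel hα r y)).map fun q => g (y, q) := by
  have h := condDistrib_comp_prodMk
    ((measurable_pivot (r + 1)).comp_aemeasurable hX.aemeasurable)
    (((measurable_trimmedSum (r + 1)).prodMk (measurable_topSum (r + 1))).comp_aemeasurable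
      hX.aemeasurable) hg
  simp only [Function.comp_def] at h
  rw [map_pivot_sample hα hX] at h
  filter_upwards [ae_of_ae_pivotLaw hα h, condDistrib_trimmedSum_topSum hα hX] with y hy hpair
  rw [hy, hpair]

lemma condDistrib_trimmedSum (hα : 0 < α)
    (hX : HasLaw X (Measure.pi fun _ => paretoMeasure 1 α) P) :
    ∀ᵐ y ∂(volume.restrict (Ioi (1 : ℝ))),
      condDistrib (fun ω => trimmedSum (X ω) (r + 1)) (fun ω => pivot (X ω) (r + 1)) P y =
        lowerKernel hα m y := by
  filter_upwards [condDistrib_comp_pivot_trimmedSum_topSum hα hX (g := fun p => p.2.1)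
    (by fun_prop)] with y hy
  rw [hy]
  exact measurePreserving_fst.map_eq

lemma condDistrib_topSum (hα : 0 < α)
    (hX : HasLaw X (Measure.pi fun _ => paretoMeasure 1 α) P) :
    ∀ᵐ y ∂(volume.restrict (Ioi (1 : ℝ))),
      condDistrib (fun ω => topSum (X ω) (r + 1)) (fun ω => pivot (X ω) (r + 1)) P y =
        upperKernel hα r y := by
  filter_upwards [condDistrib_comp_pivot_trimmedSum_topSum hα hX (g := fun p => p.2.2)
    (by fun_prop)] with y hy
  rw [hy]
  exact measurePreserving_snd.map_eq

lemma cdf_condDistrib_sum (hα : 0 < α)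
    (hX : HasLaw X (Measure.pi fun _ => paretoMeasure 1 α) P) :
    ∀ᵐ y ∂(volume.restrict (Ioi (1 : ℝ))), ∀ x,
      cdf (condDistrib (fun ω => ∑ i, X ω i) (fun ω => pivot (X ω) (r + 1)) P y) x =
        (lowerKernel hα m y ∗ upperKernel hα r y).real (Iic (x - y)) := by
  have hsum (ω : Ω) : ∑ i, X ω i =
      pivot (X ω) (r + 1) + (trimmedSum (X ω) (r + 1) + topSum (X ω) (r + 1)) := by
    rw [sum_eq_trimmedSum_add_pivot_add_topSum r.succ_pos (by lia)]
    ring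
  filter_upwards [condDistrib_comp_pivot_trimmedSum_topSum hα hX
    (g := fun p => p.1 + (p.2.1 + p.2.2)) (by fun_prop)] with y hy x
  simp only [hsum]
  rw [cdf_eq_real, hy, Measure.conv, map_measureReal_apply (by fun_prop) measurableSet_Iic,
    map_measureReal_apply (by fun_prop) measurableSet_Iic]
  congr 1
  ext q
  simp only [mem_preimage, mem_Iic, le_sub_iff_add_le']

lemma integral_pivotLaw (hα : 0 < α) (m r : ℕ) (g : ℝ → ℝ) :
    ∫ y, g y ∂(pivotLaw α m r) =
      ∫ y in Ioi 1, orderStatPDF (m + 1 + r) (m + 1) α y * g y := by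
  rw [pivotLaw, integral_withDensity_eq_integral_toReal_smul
    (measurable_orderStatPDF _ _ _).ennreal_ofReal (ae_of_all _ fun _ => ENNReal.ofReal_lt_top)]
  refine setIntegral_congr_fun measurableSet_Ioi fun y hy => ?_
  rw [ENNReal.toReal_ofReal (orderStatPDF_pos hα m r hy).le, smul_eq_mul]

lemma cdf_map_sum (hα : 0 < α)
    (hX : HasLaw X (Measure.pi fun _ => paretoMeasure 1 α) P) (x : ℝ) :
    cdf (P.map fun ω => ∑ i, X ω i) x = ∫ y in Ioi 1, orderStatPDF (m + 1 + r) (m + 1) α y *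
      (lowerKernel hα m y ∗ upperKernel hα r y).real (Iic (x - y)) := by
  have hsum : AEMeasurable (fun ω => ∑ i, X ω i) P :=
    (Finset.measurable_sum Finset.univ fun i _ => measurable_pi_apply i).comp_aemeasurable
      hX.aemeasurable
  rw [cdf_map_eq_integral_cdf_condDistrib
    ((measurable_pivot (r + 1)).comp_aemeasurable hX.aemeasurable) hsum]
  simp only [Function.comp_def]
  rw [map_pivot_sample hα hX, integral_pivotLaw hα]
  refine integral_congr_ae ?_
  filter_upwards [cdf_condDistrib_sum hα hX] with y hy
  rw [hy]

end Sample

/-! ### Comparison of convolutions -/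

section Convolution

variable {μ ν ρ : Measure ℝ} [IsProbabilityMeasure μ] [IsProbabilityMeasure ν]
  [IsProbabilityMeasure ρ]

lemma conv_real_Iic (μ ρ : Measure ℝ) [IsProbabilityMeasure μ] [IsProbabilityMeasure ρ] (s : ℝ) :
    (μ ∗ ρ).real (Iic s) = ∫ u, cdf μ (s - u) ∂ρ := by
  have hm : MeasurableSet ((fun p : ℝ × ℝ => p.1 + p.2) ⁻¹' Iic s) :=
    (measurable_fst.add measurable_snd) measurableSet_Iic
  have hcdf : AEStronglyMeasurable (fun u => cdf μ (s - u)) ρ :=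
    ((monotone_cdf μ).measurable.comp (measurable_const.sub measurable_id)).aestronglyMeasurable
  rw [measureReal_def, Measure.conv, Measure.map_apply (by fun_prop) measurableSet_Iic,
    Measure.prod_apply_symm hm,
    integral_eq_lintegral_of_nonneg_ae (ae_of_all _ fun u => cdf_nonneg μ _) hcdf]
  simp only [ofReal_cdf]
  congr! with u
  ext x
  simp only [mem_preimage, mem_Iic, le_sub_iff_add_le]

lemma integrable_cdf_sub (μ ρ : Measure ℝ) [IsFiniteMeasure ρ] (s : ℝ) :
    Integrable (fun u => cdf μ (s - u)) ρ :=
  Integrable.of_bound ((monotone_cdf μ).measurable.comp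
    (measurable_const.sub measurable_id)).aestronglyMeasurable 1 (ae_of_all _ fun u => by
      rw [Real.norm_of_nonneg (cdf_nonneg μ _)]; exact cdf_le_one μ _)

lemma abs_conv_real_Iic_sub_le (μ ν ρ : Measure ℝ) [IsProbabilityMeasure μ]
    [IsProbabilityMeasure ν] [IsProbabilityMeasure ρ] (s : ℝ) :
    |(μ ∗ ρ).real (Iic s) - (ν ∗ ρ).real (Iic s)| ≤ kolmogorovDist μ ν := by
  rw [conv_real_Iic, conv_real_Iic, ← integral_sub (integrable_cdf_sub μ ρ s)
    (integrable_cdf_sub ν ρ s)]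
  simpa using norm_integral_le_of_norm_le_const (μ := ρ)
    (f := fun u => cdf μ (s - u) - cdf ν (s - u))
    (ae_of_all _ fun u => abs_cdf_sub_cdf_le_kolmogorovDist μ ν (s - u))

lemma conv_real_Iic_eq_zero (hμ : ∀ᵐ x ∂μ, 0 < x) (hρ : ∀ᵐ x ∂ρ, 0 ≤ x) {s : ℝ} (hs : s ≤ 0) :
    (μ ∗ ρ).real (Iic s) = 0 := by
  rw [conv_real_Iic]
  refine integral_eq_zero_of_ae ?_
  filter_upwards [hρ] with u hu
  have hnull : μ (Iic (s - u)) = 0 := by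
    refine measure_mono_null (fun x hx => ?_) hμ
    simp only [mem_Iic] at hx
    simp only [mem_compl_iff, mem_ofPred_eq, not_lt]
    linarith
  rw [cdf_eq_real, measureReal_def, hnull, ENNReal.toReal_zero, Pi.zero_apply]

lemma abs_conv_real_Iic_sub_Ioc_le (hμ : ∀ᵐ x ∂μ, 0 < x) (hρ : ∀ᵐ x ∂ρ, 0 ≤ x) {s : ℝ}
    (hs : 0 ≤ s) :
    |(μ ∗ ρ).real (Iic s) - (ν ∗ ρ).real (Ioc 0 s)| ≤ 2 * kolmogorovDist μ ν := by
  have hIoc : (ν ∗ ρ).real (Ioc 0 s) = (ν ∗ ρ).real (Iic s) - (ν ∗ ρ).real (Iic 0) := by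
    rw [← Iic_sdiff_Iic, measureReal_sdiff (Iic_subset_Iic.2 hs) measurableSet_Iic]
  have hright := abs_le.1 (abs_conv_real_Iic_sub_le μ ν ρ s)
  have hleft := abs_le.1 (abs_conv_real_Iic_sub_le μ ν ρ 0)
  rw [conv_real_Iic_eq_zero hμ hρ le_rfl] at hleft
  rw [hIoc, abs_le]
  constructor <;> linarith

lemma measurable_conv_real_prodMk_preimage (κ η : Kernel ℝ ℝ) [IsMarkovKernel κ]
    [IsMarkovKernel η] {t : Set (ℝ × ℝ)} (ht : MeasurableSet t) :
    Measurable fun y => (κ y ∗ η y).real (Prod.mk y ⁻¹' t) := by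
  have hconv : ∀ y, κ y ∗ η y = ((κ ×ₖ η).map fun q => q.1 + q.2) y := fun y => by
    rw [Kernel.map_apply _ (by fun_prop), Kernel.prod_apply, Measure.conv]
  have : IsMarkovKernel ((κ ×ₖ η).map fun q : ℝ × ℝ => q.1 + q.2) :=
    Kernel.IsMarkovKernel.map _ (by fun_prop)
  simp only [hconv, measureReal_def]
  exact (Kernel.measurable_kernel_prodMk_left ht).ennreal_toReal

lemma ae_sumLaw {N : ℕ} {p q : ℝ → Prop} (hp : ∀ᵐ x ∂μ, p x) (hq : MeasurableSet {s | q s})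
    (hpq : ∀ x : Fin N → ℝ, (∀ i, p (x i)) → q (∑ i, x i)) : ∀ᵐ s ∂(sumLaw N μ), q s := by
  rw [sumLaw, ae_map_iff (by fun_prop) hq]
  have hcoord (i : Fin N) : ∀ᵐ x ∂(Measure.pi fun _ : Fin N => μ), p (x i) :=
    (measurePreserving_eval (fun _ : Fin N => μ) i).quasiMeasurePreserving.ae hp
  filter_upwards [ae_all_iff.2 hcoord] with x hx
  exact hpq x hx

lemma ae_pos_lowerKernel {α : ℝ} (hα : 0 < α) {m : ℕ} (hm : 0 < m) {y : ℝ} (hy : 1 < y) :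
    ∀ᵐ x ∂(lowerKernel hα m y), 0 < x := by
  have := isProbabilityMeasure_below hα hy
  rw [lowerKernel_of_one_lt hα m hy]
  refine ae_sumLaw (ae_below_mem_Ioo α y) measurableSet_Ioi fun x hx => ?_
  exact Finset.sum_pos (fun i _ => one_pos.trans (hx i).1) ⟨⟨0, hm⟩, Finset.mem_univ _⟩

lemma ae_nonneg_upperKernel {α : ℝ} (hα : 0 < α) (r : ℕ) {y : ℝ} (hy : 1 < y) :
    ∀ᵐ x ∂(upperKernel hα r y), 0 ≤ x := by
  have hy0 : 0 < y := one_pos.trans hy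
  have := isProbabilityMeasure_paretoMeasure hy0 hα
  rw [upperKernel_of_one_lt hα r hy]
  refine ae_sumLaw (ae_paretoMeasure_mem_Ioi y α) measurableSet_Ici fun x hx => ?_
  exact Finset.sum_nonneg fun i _ => (hy0.trans (hx i)).le

end Convolution

/-! ### The error of the normal mixture -/

section Measurability

lemma measurable_condMean (n k : ℕ) (α : ℝ) : Measurable (condMean n k α) := by
  unfold condMean
  split_ifs <;> fun_prop

lemma measurable_condVar (n k : ℕ) (α : ℝ) : Measurable (condVar n k α) := by
  unfold condVar
  split_ifs <;> fun_prop

lemma kolmogorovDist_eq_iSup_rat (μ ν : Measure ℝ) :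
    kolmogorovDist μ ν = ⨆ q : ℚ, |cdf μ q - cdf ν q| := by
  have hbdd : BddAbove (range fun q : ℚ => |cdf μ q - cdf ν q|) :=
    ⟨1, by rintro _ ⟨q, rfl⟩; exact abs_cdf_sub_cdf_le_one μ ν q⟩
  refine le_antisymm (ciSup_le fun t => ?_)
    (ciSup_le fun q => abs_cdf_sub_cdf_le_kolmogorovDist μ ν q)
  have hright (ρ : Measure ℝ) : Tendsto (cdf ρ) (𝓝[>] t) (𝓝 (cdf ρ t)) :=
    ((cdf ρ).right_continuous t).mono_left (nhdsWithin_mono _ Ioi_subset_Ici_self)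
  refine le_of_tendsto_of_frequently ((hright μ).sub (hright ν)).abs fun hnot => ?_
  obtain ⟨u, hu, hsub⟩ := mem_nhdsGT_iff_exists_Ioo_subset.1 hnot
  obtain ⟨q, htq, hqu⟩ := exists_rat_btwn (mem_Ioi.1 hu)
  exact hsub ⟨htq, hqu⟩ (le_ciSup hbdd q)

lemma measurable_kolmogorovDist {β : Type*} [MeasurableSpace β] (κ η : Kernel β ℝ)
    [IsMarkovKernel κ] [IsMarkovKernel η] : Measurable fun y => kolmogorovDist (κ y) (η y) := by
  simp only [kolmogorovDist_eq_iSup_rat, cdf_eq_real, measureReal_def]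
  have hIic (θ : Kernel β ℝ) (q : ℚ) : Measurable fun y => (θ y (Iic (q : ℝ))).toReal :=
    (θ.measurable_coe measurableSet_Iic).ennreal_toReal
  exact Measurable.iSup fun q => continuous_abs.measurable.comp ((hIic κ q).sub (hIic η q))

end Measurability

section NormalError

variable {α : ℝ} {m r : ℕ} {x y : ℝ}

/-- The normal law with the mean and the variance of `m` independent entries conditioned to lie
below the pivot: the normal approximation of the trimmed sum given the pivot. -/
def normalKernel (α : ℝ) (m : ℕ) : Kernel ℝ ℝ where
  toFun y := gaussianReal (m * condMean 1 0 α y) (m * condVar 1 0 α y).toNNReal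
  measurable' := measurable_gaussianReal.comp
    (((measurable_condMean 1 0 α).const_mul _).prodMk
      ((measurable_condVar 1 0 α).const_mul _).real_toNNReal)

instance (α : ℝ) (m : ℕ) : IsMarkovKernel (normalKernel α m) where
  isProbabilityMeasure y :=
    inferInstanceAs (IsProbabilityMeasure (gaussianReal (m * condMean 1 0 α y) _))

/-- The error `Δ_n(y)` of the normal approximation of the trimmed sum given the pivot `y`. It
depends on `n` and `k` through `m = n - k` only. -/
def normalError (hα : 0 < α) (m : ℕ) (y : ℝ) : ℝ :=
  kolmogorovDist (lowerKernel hα m y) (normalKernel α m y)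

lemma normalError_nonneg (hα : 0 < α) (m : ℕ) (y : ℝ) : 0 ≤ normalError hα m y :=
  kolmogorovDist_nonneg _ _

lemma normalError_le_one (hα : 0 < α) (m : ℕ) (y : ℝ) : normalError hα m y ≤ 1 :=
  kolmogorovDist_le_one _ _

lemma measurable_normalError (hα : 0 < α) (m : ℕ) : Measurable (normalError hα m) :=
  measurable_kolmogorovDist _ _

lemma cast_add_one_add_sub (m r : ℕ) : ((m + 1 + r : ℕ) : ℝ) - (r + 1 : ℕ) = m := by
  push_cast
  ring

lemma condVar_pos (hα : 0 < α) (hm : 0 < m) (hy : 1 < y) :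
    0 < condVar (m + 1 + r) (r + 1) α y := by
  have := condVar_one_pos hα hy
  rw [condVar_eq_mul, cast_add_one_add_sub]
  positivity

lemma condNormal_eq (m r : ℕ) (α y : ℝ) :
    condNormal (m + 1 + r) (r + 1) α y = normalKernel α m y := by
  rw [condNormal, condMean_eq_mul, condVar_eq_mul, cast_add_one_add_sub]
  rfl

lemma normexInner_eq_conv (hα : 0 < α) (hm : 0 < m) {s : ℝ} (hy : 1 < y) (hs : 0 ≤ s) :
    normexInner (m + 1 + r) (r + 1) α y s =
      (normalKernel α m y ∗ upperKernel hα r y).real (Ioc 0 s) := by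
  rw [normexInner_eq hα (one_pos.trans hy) (condVar_pos hα hm hy) hs, condNormal_eq,
    upperKernel_of_one_lt hα r hy]

lemma abs_conv_real_Iic_sub_normexInner_le (hα : 0 < α) (hm : 0 < m) (hy : 1 < y) (hx : y ≤ x) :
    |(lowerKernel hα m y ∗ upperKernel hα r y).real (Iic (x - y)) -
      normexInner (m + 1 + r) (r + 1) α y (x - y)| ≤ 2 * normalError hα m y := by
  rw [normexInner_eq_conv hα hm hy (sub_nonneg.2 hx)]
  exact abs_conv_real_Iic_sub_Ioc_le (ae_pos_lowerKernel hα hm hy) (ae_nonneg_upperKernel hα r hy)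
    (sub_nonneg.2 hx)

lemma normexCDF_eq (m r : ℕ) (α : ℝ) (hx : 1 ≤ x) :
    normexCDF (m + 1 + r) (r + 1) α x = ∫ y in (1 : ℝ)..x,
      orderStatPDF (m + 1 + r) (m + 1) α y * normexInner (m + 1 + r) (r + 1) α y (x - y) := by
  rcases r with _ | r
  · rw [normexCDF, if_pos rfl, ← intervalIntegral.integral_const_mul]
    refine intervalIntegral.integral_congr fun y hy => ?_
    rw [uIcc_of_le hx] at hy
    have hy0 : 0 < y := one_pos.trans_le hy.1
    have hfact : (m.factorial : ℝ) ≠ 0 := Nat.cast_ne_zero.2 m.factorial_ne_zero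
    have hpdf : orderStatPDF (m + 1 + 0) (m + 1) α y =
        (m + 1) * α * ((1 - y ^ (-α)) ^ m / y ^ (1 + α)) := by
      rw [orderStatPDF_eq, Nat.add_zero, Nat.factorial_succ, Nat.factorial_zero,
        show -(α * ((0 : ℕ) + 1)) - 1 = -(1 + α) by push_cast; ring,
        Real.rpow_neg hy0.le (1 + α)]
      push_cast
      field_simp
    simp only [hpdf, add_zero, zero_add, Nat.add_sub_cancel]
    push_cast
    ring
  · rw [normexCDF, if_neg (by lia), show m + 1 + (r + 1) - (r + 1 + 1) + 1 = m + 1 by lia]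

lemma normexCDF_eq_integral_conv (hα : 0 < α) (hm : 0 < m) (hx : 1 ≤ x) :
    normexCDF (m + 1 + r) (r + 1) α x = ∫ y in (1 : ℝ)..x,
      orderStatPDF (m + 1 + r) (m + 1) α y *
        (normalKernel α m y ∗ upperKernel hα r y).real (Ioc 0 (x - y)) := by
  rw [normexCDF_eq m r α hx]
  refine intervalIntegral.integral_congr_ae (ae_of_all _ fun y hy => ?_)
  rw [uIoc_of_le hx] at hy
  rw [normexInner_eq_conv hα hm hy.1 (sub_nonneg.2 hy.2)]

lemma integrableOn_orderStatPDF_mul (hα : 0 < α) (m r : ℕ) {g : ℝ → ℝ} (hg : Measurable g)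
    (hg0 : ∀ y, 0 ≤ g y) (hg1 : ∀ y, g y ≤ 1) :
    IntegrableOn (fun y => orderStatPDF (m + 1 + r) (m + 1) α y * g y) (Ioi 1) :=
  (integrableOn_orderStatPDF hα m r).mul_bdd (c := 1) hg.aestronglyMeasurable
    (ae_of_all _ fun y => by rw [Real.norm_of_nonneg (hg0 y)]; exact hg1 y)

lemma intervalIntegrable_orderStatPDF_mul (hα : 0 < α) (m r : ℕ) {g : ℝ → ℝ} (hg : Measurable g)
    (hg0 : ∀ y, 0 ≤ g y) (hg1 : ∀ y, g y ≤ 1) (hx : 1 ≤ x) :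
    IntervalIntegrable (fun y => orderStatPDF (m + 1 + r) (m + 1) α y * g y) volume 1 x :=
  (intervalIntegrable_iff_integrableOn_Ioc_of_le hx).2
    ((integrableOn_orderStatPDF_mul hα m r hg hg0 hg1).mono_set Ioc_subset_Ioi_self)

section Sample

variable {Ω : Type*} [MeasurableSpace Ω] {P : Measure Ω} [IsProbabilityMeasure P]
  {X : Ω → Fin (m + 1 + r) → ℝ}

lemma cdf_map_sum_eq_intervalIntegral (hα : 0 < α) (hm : 0 < m)
    (hX : HasLaw X (Measure.pi fun _ => paretoMeasure 1 α) P) (hx : 1 ≤ x) :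
    cdf (P.map fun ω => ∑ i, X ω i) x = ∫ y in (1 : ℝ)..x,
      orderStatPDF (m + 1 + r) (m + 1) α y *
        (lowerKernel hα m y ∗ upperKernel hα r y).real (Iic (x - y)) := by
  rw [cdf_map_sum hα hX, intervalIntegral.integral_of_le hx]
  refine setIntegral_eq_of_subset_of_forall_sdiff_eq_zero measurableSet_Ioi
    Ioc_subset_Ioi_self ?_
  rintro y ⟨hy, hyx⟩
  have hxy : x < y := not_le.1 fun hle => hyx ⟨hy, hle⟩
  rw [conv_real_Iic_eq_zero (ae_pos_lowerKernel hα hm hy) (ae_nonneg_upperKernel hα r hy)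
    (sub_nonpos.2 hxy.le), mul_zero]

theorem abs_cdf_sub_normexCDF_le (hα : 0 < α) (hm : 0 < m)
    (hX : HasLaw X (Measure.pi fun _ => paretoMeasure 1 α) P) (hx : 1 ≤ x) :
    |cdf (P.map fun ω => ∑ i, X ω i) x - normexCDF (m + 1 + r) (r + 1) α x| ≤
      2 * ∫ y in (1 : ℝ)..x, orderStatPDF (m + 1 + r) (m + 1) α y * normalError hα m y := by
  have hIic : MeasurableSet {p : ℝ × ℝ | p.2 ≤ x - p.1} :=
    measurableSet_le (by fun_prop) (by fun_prop)
  have hIoc : MeasurableSet {p : ℝ × ℝ | 0 < p.2 ∧ p.2 ≤ x - p.1} :=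
    (measurableSet_lt measurable_const measurable_snd).inter hIic
  have hexact : IntervalIntegrable (fun y => orderStatPDF (m + 1 + r) (m + 1) α y *
      (lowerKernel hα m y ∗ upperKernel hα r y).real (Iic (x - y))) volume 1 x :=
    intervalIntegrable_orderStatPDF_mul hα m r
      (measurable_conv_real_prodMk_preimage (lowerKernel hα m) (upperKernel hα r) hIic)
      (fun _ => measureReal_nonneg) (fun _ => measureReal_le_one) hx
  have happrox : IntervalIntegrable (fun y => orderStatPDF (m + 1 + r) (m + 1) α y *
      (normalKernel α m y ∗ upperKernel hα r y).real (Ioc 0 (x - y))) volume 1 x :=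
    intervalIntegrable_orderStatPDF_mul hα m r
      (measurable_conv_real_prodMk_preimage (normalKernel α m) (upperKernel hα r) hIoc)
      (fun _ => measureReal_nonneg) (fun _ => measureReal_le_one) hx
  have herror := intervalIntegrable_orderStatPDF_mul hα m r (measurable_normalError hα m)
    (normalError_nonneg hα m) (normalError_le_one hα m) hx
  rw [cdf_map_sum_eq_intervalIntegral hα hm hX hx, normexCDF_eq_integral_conv hα hm hx,
    ← intervalIntegral.integral_sub hexact happrox, ← intervalIntegral.integral_const_mul,
    ← Real.norm_eq_abs]
  refine intervalIntegral.norm_integral_le_of_norm_le hx (ae_of_all _ fun y hy => ?_)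
    (herror.const_mul 2)
  have hpdf := orderStatPDF_pos hα m r hy.1
  have hdist := abs_conv_real_Iic_sub_normexInner_le (r := r) hα hm hy.1 hy.2
  rw [normexInner_eq_conv hα hm hy.1 (sub_nonneg.2 hy.2)] at hdist
  rw [← mul_sub, norm_mul, Real.norm_of_nonneg hpdf.le, mul_left_comm]
  exact mul_le_mul_of_nonneg_left hdist hpdf.le

end Sample

lemma intervalIntegral_normalError_le (hα : 0 < α) (hx : 1 ≤ x) :
    ∫ y in (1 : ℝ)..x, orderStatPDF (m + 1 + r) (m + 1) α y * normalError hα m y ≤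
      ∫ y, normalError hα m y ∂(pivotLaw α m r) := by
  rw [integral_pivotLaw hα, intervalIntegral.integral_of_le hx]
  refine setIntegral_mono_set (μ := volume) (integrableOn_orderStatPDF_mul hα m r
    (measurable_normalError hα m) (normalError_nonneg hα m) (normalError_le_one hα m)) ?_
    (Eventually.of_forall Ioc_subset_Ioi_self)
  filter_upwards [ae_restrict_mem measurableSet_Ioi] with y hy
  exact mul_nonneg (orderStatPDF_pos hα m r hy).le (normalError_nonneg hα m y)

lemma abs_sub_integral_below_le (hα : 0 < α) (hy : 1 < y) :
    ∀ᵐ x ∂(below α y), |x - ∫ t, t ∂(below α y)| ≤ y := by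
  have := isProbabilityMeasure_below hα hy
  have hbdd : ∀ᵐ x ∂(below α y), x ∈ Icc 0 y := (ae_below_mem_Ioo α y).mono fun x hx =>
    ⟨(one_pos.trans hx.1).le, hx.2.le⟩
  have hmean : ∫ t, t ∂(below α y) ∈ Icc 0 y := (convex_Icc 0 y).integral_mem isClosed_Icc hbdd
    ((memLp_below hα hy).integrable (by norm_num))
  filter_upwards [hbdd] with x hx
  exact (abs_sub_le_of_nonneg_of_le hx.1 hx.2 hmean.1 hmean.2)

/-- The entries below the pivot are bounded by it, so the central limit theorem is uniform over
pivots that are small compared to the conditional standard deviation. -/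
lemma exists_forall_normalError_le (hα : 0 < α) {ε : ℝ} (hε : 0 < ε) :
    ∃ δ > 0, ∀ (m : ℕ) (y : ℝ), 1 < y → y ≤ δ * √(m * condVar 1 0 α y) →
      normalError hα m y ≤ ε := by
  obtain ⟨δ, hδ, hclt⟩ := exists_forall_kolmogorovDist_sumLaw_le hε
  refine ⟨δ, hδ, fun m y hy hyδ => ?_⟩
  have := isProbabilityMeasure_below hα hy
  have hpos : 0 < m * condVar 1 0 α y :=
    Real.sqrt_pos.1 (pos_of_mul_pos_right (one_pos.trans (hy.trans_le hyδ)) hδ.le)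
  have h := hclt m (below α y) y (abs_sub_integral_below_le hα hy)
  rw [variance_below hα hy, integral_id_below hα hy] at h
  rw [normalError, lowerKernel_of_one_lt hα m hy]
  exact h hpos hyδ

lemma tendsto_normalError (hα : 0 < α) (hy : 1 < y) :
    Tendsto (fun m => normalError hα m y) atTop (𝓝 0) := by
  refine tendsto_order.2 ⟨fun a ha => .of_forall fun m => ha.trans_le (normalError_nonneg hα m y),
    fun a ha => ?_⟩
  obtain ⟨δ, hδ, hle⟩ := exists_forall_normalError_le hα (half_pos ha)
  have hstd : Tendsto (fun m : ℕ => δ * √(m * condVar 1 0 α y)) atTop atTop :=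
    (Real.tendsto_sqrt_atTop.comp (tendsto_natCast_atTop_atTop.atTop_mul_const
      (condVar_one_pos hα hy))).const_mul_atTop hδ
  filter_upwards [hstd.eventually_ge_atTop y] with m hm
  exact (hle m y hy hm).trans_lt (half_lt_self ha)

end NormalError

/-! ### Tails of the pivot -/

section PivotTails

variable {α : ℝ}

lemma factorial_div_le_pow (m r : ℕ) :
    ((m + 1 + r).factorial : ℝ) / (m.factorial * r.factorial) ≤ (m + 1 + r : ℝ) ^ (r + 1) := by
  have hdesc := Nat.factorial_mul_descFactorial (show r + 1 ≤ m + 1 + r by lia)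
  rw [show m + 1 + r - (r + 1) = m by lia] at hdesc
  have hpow := Nat.descFactorial_le_pow (m + 1 + r) (r + 1)
  have hm : (0 : ℝ) < m.factorial := by exact_mod_cast m.factorial_pos
  have hr : (1 : ℝ) ≤ r.factorial := by exact_mod_cast r.factorial_pos
  rw [← hdesc, Nat.cast_mul, mul_div_mul_left _ _ hm.ne']
  exact (div_le_self (by positivity) hr).trans (by exact_mod_cast hpow)

lemma orderStatPDF_le (hα : 0 < α) (m r : ℕ) {y : ℝ} (hy : 1 < y) :
    orderStatPDF (m + 1 + r) (m + 1) α y ≤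
      (m + 1 + r : ℝ) ^ (r + 1) * α * (1 - y ^ (-α)) ^ m * y ^ (-(α * (r + 1)) - 1) := by
  have : 0 < y := one_pos.trans hy
  have := one_sub_rpow_neg_pos hα hy
  rw [orderStatPDF_eq]
  gcongr
  exact factorial_div_le_pow m r

lemma pivotLaw_real_le (hα : 0 < α) (m r : ℕ) {s : Set ℝ} (hs : MeasurableSet s) {g : ℝ → ℝ}
    (hg : IntegrableOn g (Ioi 1 ∩ s))
    (hle : ∀ y ∈ Ioi 1 ∩ s, orderStatPDF (m + 1 + r) (m + 1) α y ≤ g y) :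
    (pivotLaw α m r).real s ≤ ∫ y in Ioi 1 ∩ s, g y := by
  rw [← integral_indicator_one hs, integral_pivotLaw hα]
  simp only [← indicator_mul_right, Pi.one_apply, mul_one]
  rw [setIntegral_indicator hs]
  exact setIntegral_mono_on ((integrableOn_orderStatPDF hα m r).mono_set inter_subset_left) hg
    (measurableSet_Ioi.inter hs) hle

lemma pivotLaw_real_Ioi_le (hα : 0 < α) (m r : ℕ) {t : ℝ} (ht : 1 ≤ t) :
    (pivotLaw α m r).real (Ioi t) ≤ (m + 1 + r : ℝ) ^ (r + 1) * t ^ (-(α * (r + 1))) := by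
  have ht0 : 0 < t := one_pos.trans_le ht
  have hp : 0 < α * ((r : ℝ) + 1) := by positivity
  have hinter : Ioi 1 ∩ Ioi t = Ioi t := inter_eq_right.2 (Ioi_subset_Ioi ht)
  calc (pivotLaw α m r).real (Ioi t)
      ≤ ∫ y in Ioi 1 ∩ Ioi t, (m + 1 + r : ℝ) ^ (r + 1) * α * y ^ (-(α * (r + 1)) - 1) := by
        refine pivotLaw_real_le hα m r measurableSet_Ioi ?_ fun y hy => ?_
        · rw [hinter]
          exact (integrableOn_Ioi_rpow_of_lt (by linarith) ht0).const_mul _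
        · have hy0 : 0 < y := one_pos.trans hy.1
          have hpow : (1 - y ^ (-α)) ^ m ≤ 1 :=
            pow_le_one₀ (one_sub_rpow_neg_pos hα hy.1).le
              (sub_le_self _ (Real.rpow_nonneg hy0.le _))
          exact (orderStatPDF_le hα m r hy.1).trans (mul_le_mul_of_nonneg_right
            (mul_le_of_le_one_right (by positivity) hpow) (by positivity))
    _ = (m + 1 + r : ℝ) ^ (r + 1) * t ^ (-(α * (r + 1))) / (r + 1) := by
        rw [hinter, integral_const_mul, integral_Ioi_rpow_of_lt (by linarith) ht0, sub_add_cancel]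
        field_simp
    _ ≤ (m + 1 + r : ℝ) ^ (r + 1) * t ^ (-(α * (r + 1))) :=
        div_le_self (by positivity) (le_add_of_nonneg_left r.cast_nonneg)

lemma pivotLaw_real_Iic_le (hα : 0 < α) (m r : ℕ) {b : ℝ} (hb : 1 < b) :
    (pivotLaw α m r).real (Iic b) ≤
      (m + 1 + r : ℝ) ^ (r + 1) * α * (1 - b ^ (-α)) ^ m * (b - 1) := by
  have hp : 0 < α * ((r : ℝ) + 1) := by positivity
  have := one_sub_rpow_neg_pos hα hb
  refine (pivotLaw_real_le hα m r (g := fun _ => (m + 1 + r : ℝ) ^ (r + 1) * α *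
    (1 - b ^ (-α)) ^ m) measurableSet_Iic ?_ fun y hy => ?_).trans_eq ?_
  · rw [Ioi_inter_Iic]
    exact integrableOn_const measure_Ioc_lt_top.ne
  · have hy0 : 0 < y := one_pos.trans hy.1
    have hw := one_sub_rpow_neg_pos hα hy.1
    have hbase : b ^ (-α) ≤ y ^ (-α) := Real.rpow_le_rpow_of_nonpos hy0 hy.2 (by linarith)
    have hle1 : y ^ (-(α * ((r : ℝ) + 1)) - 1) ≤ 1 :=
      Real.rpow_le_one_of_one_le_of_nonpos (mem_Ioi.1 hy.1).le (by linarith)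
    refine (orderStatPDF_le hα m r hy.1).trans
      ((mul_le_of_le_one_right (by positivity) hle1).trans ?_)
    gcongr
  · rw [Ioi_inter_Iic, setIntegral_const, Real.volume_real_Ioc_of_le hb.le, smul_eq_mul, mul_comm]

lemma tendsto_pivotLaw_real_Iic (hα : 0 < α) (r : ℕ) {b : ℝ} (hb : 1 < b) :
    Tendsto (fun m => (pivotLaw α m r).real (Iic b)) atTop (𝓝 0) := by
  set q := 1 - b ^ (-α) with hq_def
  have hq : 0 < q := one_sub_rpow_neg_pos hα hb
  have hq1 : q < 1 := sub_lt_self _ (Real.rpow_pos_of_pos (one_pos.trans hb) _)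
  have hgeom : Tendsto (fun m : ℕ => ((m + (1 + r) : ℕ) : ℝ) ^ (r + 1) * q ^ (m + (1 + r)) *
      ((q ^ (1 + r))⁻¹ * α * (b - 1))) atTop (𝓝 0) := by
    simpa only [Function.comp_def, zero_mul] using
      ((tendsto_pow_const_mul_const_pow_of_abs_lt_one (r + 1) (by rwa [abs_of_pos hq])).comp
        (tendsto_add_atTop_nat (1 + r))).mul_const ((q ^ (1 + r))⁻¹ * α * (b - 1))
  refine squeeze_zero (fun _ => measureReal_nonneg) (fun m => ?_) hgeom
  refine (pivotLaw_real_Iic_le hα m r hb).trans_eq ?_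
  rw [← hq_def, pow_add q]
  push_cast
  field_simp
  ring

/-- Compared with `√m`, the pivot is of order `m ^ (1 / α - 1 / 2)`. -/
lemma pivotLaw_real_Ioi_mul_sqrt_le (hα : 0 < α) {m r : ℕ} (hm : r + 1 ≤ m) {c : ℝ}
    (hc : 1 ≤ c * √m) :
    (pivotLaw α m r).real (Ioi (c * √m)) ≤ (2 * c ^ (-α) * (m : ℝ) ^ (1 - α / 2)) ^ (r + 1) := by
  have hm0 : (0 : ℝ) < m := by exact_mod_cast (Nat.succ_pos r).trans_le hm
  have hmr : (r + 1 : ℝ) ≤ m := by exact_mod_cast hm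
  have hc0 : 0 < c := pos_of_mul_pos_left (one_pos.trans_le hc) (Real.sqrt_nonneg _)
  have hpow : (c * √m) ^ (-(α * (r + 1))) = (c ^ (-α) * (m : ℝ) ^ (-(α / 2))) ^ (r + 1) := by
    rw [← neg_mul, Real.rpow_mul (by positivity), Real.mul_rpow hc0.le (Real.sqrt_nonneg _),
      Real.sqrt_eq_rpow, ← Real.rpow_mul hm0.le, show 1 / 2 * -α = -(α / 2) by ring]
    exact_mod_cast Real.rpow_natCast _ (r + 1)
  calc (pivotLaw α m r).real (Ioi (c * √m))
      ≤ (m + 1 + r : ℝ) ^ (r + 1) * (c * √m) ^ (-(α * (r + 1))) := pivotLaw_real_Ioi_le hα m r hc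
    _ ≤ (2 * m) ^ (r + 1) * (c ^ (-α) * (m : ℝ) ^ (-(α / 2))) ^ (r + 1) := by
        rw [hpow]
        gcongr
        linarith
    _ = (2 * c ^ (-α) * (m : ℝ) ^ (1 - α / 2)) ^ (r + 1) := by
        rw [← mul_pow, sub_eq_add_neg, Real.rpow_add hm0, Real.rpow_one]
        ring

end PivotTails

section PivotNegligible

variable {α : ℝ}

lemma tendsto_condVar_of_two_lt (hα : 2 < α) :
    Tendsto (condVar 1 0 α) atTop (𝓝 (α / ((α - 2) * (α - 1) ^ 2))) := by
  have hα0 : α ≠ 0 := by linarith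
  have hα1 : α - 1 ≠ 0 := by linarith
  have hα2 : α - 2 ≠ 0 := by linarith
  have h0 : Tendsto (fun y : ℝ => 1 - y ^ (-α)) atTop (𝓝 (1 - 0)) :=
    (tendsto_rpow_neg_atTop (by linarith)).const_sub 1
  have h1 : Tendsto (fun y : ℝ => 1 - y ^ (1 - α)) atTop (𝓝 (1 - 0)) := by
    simpa only [neg_sub] using (tendsto_rpow_neg_atTop (y := α - 1) (by linarith)).const_sub 1
  have h2 : Tendsto (fun y : ℝ => 1 - y ^ (2 - α)) atTop (𝓝 (1 - 0)) := by
    simpa only [neg_sub] using (tendsto_rpow_neg_atTop (y := α - 2) (by linarith)).const_sub 1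
  have hcondVar : condVar 1 0 α = fun y => ((1 : ℕ) - (0 : ℕ) : ℝ) / (1 - y ^ (-α)) *
      ((1 - y ^ (2 - α)) / (1 - 2 / α) -
        1 / (1 - 1 / α) ^ 2 * ((1 - y ^ (1 - α)) ^ 2 / (1 - y ^ (-α)))) := by
    ext y
    rw [condVar, if_neg (by linarith), if_neg (by linarith)]
  have hlim := ((tendsto_const_nhds (x := ((1 : ℕ) - (0 : ℕ) : ℝ))).div h0 (by norm_num)).mul
    ((h2.div_const (1 - 2 / α)).sub
      (((h1.pow 2).div h0 (by norm_num)).const_mul (1 / (1 - 1 / α) ^ 2)))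
  have hval : α / ((α - 2) * (α - 1) ^ 2) = ((1 : ℕ) - (0 : ℕ) : ℝ) / (1 - 0) *
      ((1 - 0) / (1 - 2 / α) - 1 / (1 - 1 / α) ^ 2 * ((1 - 0) ^ 2 / (1 - 0))) := by
    rw [one_sub_div hα0, one_sub_div hα0]
    norm_num
    field_simp
    ring
  rwa [hcondVar, hval]

lemma tendsto_condVar_two : Tendsto (condVar 1 0 2) atTop atTop := by
  have hlog : Tendsto (fun y : ℝ => 2 * (Real.log y - 2)) atTop atTop :=
    (tendsto_atTop_add_const_right _ (-2) Real.tendsto_log_atTop).const_mul_atTop two_pos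
  refine tendsto_atTop_mono' _ ?_ hlog
  filter_upwards [eventually_gt_atTop (1 : ℝ), Real.tendsto_log_atTop.eventually_ge_atTop 2]
    with y hy hlogy
  have hfactor : 1 ≤ y ^ 2 / (y ^ 2 - 1) := by
    rw [le_div_iff₀ (by nlinarith)]
    linarith
  have hratio : (y - 1) / (y + 1) ≤ 1 := by
    rw [div_le_one (by linarith)]
    linarith
  rw [condVar, if_neg (by norm_num), if_pos rfl]
  push_cast
  calc 2 * (Real.log y - 2) ≤ 2 * 1 * (Real.log y - 2 * ((y - 1) / (y + 1))) := by linarith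
    _ ≤ 2 * (1 - 0) * (y ^ 2 / (y ^ 2 - 1)) * (Real.log y - 2 * ((y - 1) / (y + 1))) := by
        gcongr
        · linarith
        · linarith

-- For `2 < α` the power of `m` does the job. For `α = 2` there is none left, but the conditional
-- variance diverges, so that `M` can be taken large.
lemma exists_le_condVar_and_eventually_le (hα : 2 ≤ α) {δ ε : ℝ} (hδ : 0 < δ) (hε : 0 < ε) :
    ∃ M > 0, (∀ᶠ y in atTop, M ≤ condVar 1 0 α y) ∧
      ∀ᶠ m : ℕ in atTop, 2 * (δ * √M) ^ (-α) * (m : ℝ) ^ (1 - α / 2) ≤ ε := by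
  rcases hα.eq_or_lt with rfl | hα
  · refine ⟨2 / (δ ^ 2 * ε), by positivity, tendsto_condVar_two.eventually_ge_atTop _, ?_⟩
    refine .of_forall fun m => le_of_eq ?_
    rw [Real.rpow_neg (by positivity), Real.rpow_two, mul_pow, Real.sq_sqrt (by positivity)]
    norm_num
    field_simp
  · have hlim : 0 < α / ((α - 2) * (α - 1) ^ 2) :=
      div_pos (by linarith) (mul_pos (by linarith) (pow_pos (by linarith) 2))
    obtain ⟨M, hM, hMlt⟩ := exists_between hlim
    refine ⟨M, hM, ((tendsto_condVar_of_two_lt hα).eventually_const_lt hMlt).mono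
      fun _ => le_of_lt, ?_⟩
    have hpow : Tendsto (fun m : ℕ => 2 * (δ * √M) ^ (-α) * (m : ℝ) ^ (1 - α / 2)) atTop (𝓝 0) := by
      simpa only [neg_sub, mul_zero, Function.comp_def] using
        ((tendsto_rpow_neg_atTop (y := α / 2 - 1) (by linarith)).comp
          tendsto_natCast_atTop_atTop).const_mul (2 * (δ * √M) ^ (-α))
    exact hpow.eventually_le_const hε

/-- The pivot is negligible compared to the conditional standard deviation of the trimmed sum. -/
lemma exists_eventually_pivotLaw_real_Ioi_le (hα : 2 ≤ α) (r : ℕ) {δ ε : ℝ} (hδ : 0 < δ)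
    (hε : 0 < ε) :
    ∃ M > 0, (∀ᶠ y in atTop, M ≤ condVar 1 0 α y) ∧
      ∀ᶠ m : ℕ in atTop, (pivotLaw α m r).real (Ioi (δ * √M * √m)) ≤ ε := by
  obtain ⟨M, hM, hvar, hbase⟩ :=
    exists_le_condVar_and_eventually_le hα hδ (lt_min hε one_pos)
  have hsqrt : Tendsto (fun m : ℕ => δ * √M * √m) atTop atTop :=
    (Real.tendsto_sqrt_atTop.comp tendsto_natCast_atTop_atTop).const_mul_atTop (by positivity)
  refine ⟨M, hM, hvar, ?_⟩
  filter_upwards [hbase, eventually_ge_atTop (r + 1), hsqrt.eventually_ge_atTop 1]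
    with m hmin hm h1
  refine (pivotLaw_real_Ioi_mul_sqrt_le (by linarith) hm h1).trans ?_
  exact (pow_le_of_le_one (by positivity) (hmin.trans (min_le_right _ _)) r.succ_ne_zero).trans
    (hmin.trans (min_le_left _ _))

lemma integral_le_add_measureReal {β : Type*} [MeasurableSpace β] {μ : Measure β}
    [IsProbabilityMeasure μ] {f : β → ℝ} {s : Set β} {ε : ℝ} (hs : MeasurableSet s) (hε : 0 ≤ ε)
    (h0 : ∀ y, 0 ≤ f y) (h1 : ∀ y, f y ≤ 1) (hf : ∀ y ∉ s, f y ≤ ε) :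
    ∫ y, f y ∂μ ≤ ε + μ.real s := by
  have hind : Integrable (s.indicator (1 : β → ℝ)) μ := (integrable_const 1).indicator hs
  calc ∫ y, f y ∂μ ≤ ∫ y, (ε + s.indicator 1 y) ∂μ := by
        refine integral_mono_of_nonneg (ae_of_all _ h0) ((integrable_const ε).add hind)
          (ae_of_all _ fun y => ?_)
        by_cases hy : y ∈ s
        · simpa only [indicator_of_mem hy, Pi.one_apply] using
            (h1 y).trans (le_add_of_nonneg_left hε)
        · simpa only [indicator_of_notMem hy, add_zero] using hf y hy
    _ = ε + μ.real s := by
        rw [integral_add (integrable_const ε) hind, integral_const, probReal_univ, one_smul,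
          integral_indicator_one hs]

theorem tendsto_integral_normalError (hα₀ : 0 < α) (hα : 2 ≤ α) (r : ℕ) :
    Tendsto (fun m => ∫ y, normalError hα₀ m y ∂(pivotLaw α m r)) atTop (𝓝 0) := by
  refine tendsto_order.2 ⟨fun a ha => .of_forall fun m =>
    ha.trans_le (integral_nonneg (normalError_nonneg hα₀ m)), fun a ha => ?_⟩
  have hε : 0 < a / 4 := by positivity
  obtain ⟨δ, hδ, hclt⟩ := exists_forall_normalError_le hα₀ hε
  obtain ⟨M, hM, hvar, hhigh⟩ := exists_eventually_pivotLaw_real_Ioi_le hα r hδ hε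
  obtain ⟨b, hb⟩ := eventually_atTop.1 hvar
  have hlow := (tendsto_pivotLaw_real_Iic hα₀ r (lt_max_of_lt_right one_lt_two :
    1 < max b 2)).eventually_le_const hε
  filter_upwards [hlow, hhigh] with m hlow hhigh
  have := isProbabilityMeasure_pivotLaw hα₀ m r
  have hle := integral_le_add_measureReal (μ := pivotLaw α m r)
    (s := Iic (max b 2) ∪ Ioi (δ * √M * √m)) (measurableSet_Iic.union measurableSet_Ioi) hε.le
    (normalError_nonneg hα₀ m) (normalError_le_one hα₀ m) fun y hy => ?_
  · linarith [measureReal_union_le (μ := pivotLaw α m r) (Iic (max b 2)) (Ioi (δ * √M * √m))]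
  · simp only [mem_union, mem_Iic, mem_Ioi, not_or, not_le, not_lt, max_lt_iff] at hy
    refine hclt m y (one_lt_two.trans hy.1.2) (hy.2.trans ?_)
    rw [mul_assoc, ← Real.sqrt_mul hM.le, mul_comm M]
    gcongr
    exact hb y hy.1.1.le

end PivotNegligible

/-! ### The conditional laws and the approximation -/

section FixedSize

variable {α : ℝ} {m r : ℕ} {Ω : Type*} [MeasurableSpace Ω] {P : Measure Ω}
  [IsProbabilityMeasure P] {X : Ω → Fin (m + 1 + r) → ℝ}

lemma condDistrib_trimmedSum_topSum_eq_prod (hα : 0 < α)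
    (hX : HasLaw X (Measure.pi fun _ => paretoMeasure 1 α) P) :
    ∀ᵐ y ∂(volume.restrict (Ioi (1 : ℝ))),
      condDistrib (fun ω => (trimmedSum (X ω) (r + 1), topSum (X ω) (r + 1)))
          (fun ω => pivot (X ω) (r + 1)) P y =
        (condDistrib (fun ω => trimmedSum (X ω) (r + 1)) (fun ω => pivot (X ω) (r + 1)) P y).prod
          (condDistrib (fun ω => topSum (X ω) (r + 1)) (fun ω => pivot (X ω) (r + 1)) P y) := by
  filter_upwards [condDistrib_trimmedSum_topSum hα hX, condDistrib_trimmedSum hα hX,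
    condDistrib_topSum hα hX] with y hpair hlower hupper
  rw [hpair, hlower, hupper]

lemma condDistrib_topSum_eq_withDensity (hα : 0 < α) (hr : 0 < r)
    (hX : HasLaw X (Measure.pi fun _ => paretoMeasure 1 α) P) :
    ∀ᵐ y ∂(volume.restrict (Ioi (1 : ℝ))),
      condDistrib (fun ω => topSum (X ω) (r + 1)) (fun ω => pivot (X ω) (r + 1)) P y =
        volume.withDensity fun u => ENNReal.ofReal (convPow (upperPDF α y) r u) := by
  obtain ⟨N, rfl⟩ := Nat.exists_eq_add_one.2 hr
  filter_upwards [condDistrib_topSum hα hX, ae_restrict_mem measurableSet_Ioi] with y hupper hy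
  rw [hupper, upperKernel_of_one_lt hα _ hy, sumLaw_paretoMeasure hα (one_pos.trans hy)]

lemma condDistrib_trimmedSum_moments (hα : 0 < α) (hm : 0 < m)
    (hX : HasLaw X (Measure.pi fun _ => paretoMeasure 1 α) P) :
    ∀ᵐ y ∂(volume.restrict (Ioi (1 : ℝ))),
      MemLp id 2
        (condDistrib (fun ω => trimmedSum (X ω) (r + 1)) (fun ω => pivot (X ω) (r + 1)) P y) ∧
      ∫ t, t ∂(condDistrib (fun ω => trimmedSum (X ω) (r + 1))
        (fun ω => pivot (X ω) (r + 1)) P y) = condMean (m + 1 + r) (r + 1) α y ∧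
      variance id (condDistrib (fun ω => trimmedSum (X ω) (r + 1))
        (fun ω => pivot (X ω) (r + 1)) P y) = condVar (m + 1 + r) (r + 1) α y ∧
      0 < condVar (m + 1 + r) (r + 1) α y := by
  filter_upwards [condDistrib_trimmedSum hα hX, ae_restrict_mem measurableSet_Ioi] with y hlower hy
  have := isProbabilityMeasure_below hα hy
  have hmem := memLp_below hα hy
  rw [hlower, lowerKernel_of_one_lt hα m hy]
  refine ⟨memLp_sumLaw m hmem, ?_, ?_, condVar_pos hα hm hy⟩
  · rw [integral_sumLaw m hmem, integral_id_below hα hy, condMean_eq_mul (m + 1 + r),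
      cast_add_one_add_sub]
  · rw [variance_sumLaw m hmem, variance_below hα hy, condVar_eq_mul (m + 1 + r),
      cast_add_one_add_sub]

lemma kolmogorovDist_condDistrib_trimmedSum (hα : 0 < α)
    (hX : HasLaw X (Measure.pi fun _ => paretoMeasure 1 α) P) :
    ∀ᵐ y ∂(volume.restrict (Ioi (1 : ℝ))),
      kolmogorovDist
          (condDistrib (fun ω => trimmedSum (X ω) (r + 1)) (fun ω => pivot (X ω) (r + 1)) P y)
          (condNormal (m + 1 + r) (r + 1) α y) = normalError hα m y := by
  filter_upwards [condDistrib_trimmedSum hα hX] with y hlower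
  rw [hlower, condNormal_eq, normalError]

theorem abs_cdf_sub_normexCDF_le_integral_kolmogorovDist (hα : 0 < α) (hm : 0 < m)
    (hX : HasLaw X (Measure.pi fun _ => paretoMeasure 1 α) P) {x : ℝ} (hx : 1 ≤ x) :
    |cdf (P.map fun ω => ∑ i, X ω i) x - normexCDF (m + 1 + r) (r + 1) α x| ≤
      2 * ∫ y in (1 : ℝ)..x, orderStatPDF (m + 1 + r) (m + 1) α y *
        kolmogorovDist
          (condDistrib (fun ω => trimmedSum (X ω) (r + 1)) (fun ω => pivot (X ω) (r + 1)) P y)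
          (condNormal (m + 1 + r) (r + 1) α y) := by
  refine (abs_cdf_sub_normexCDF_le hα hm hX hx).trans_eq (congrArg (2 * ·) ?_)
  refine intervalIntegral.integral_congr_ae ?_
  filter_upwards [(ae_restrict_iff' measurableSet_Ioi).1
    (kolmogorovDist_condDistrib_trimmedSum hα hX)] with y hdist hy
  rw [uIoc_of_le hx] at hy
  rw [hdist hy.1]

lemma abs_cdf_condDistrib_sum_sub_normexInner_le (hα : 0 < α) (hm : 0 < m)
    (hX : HasLaw X (Measure.pi fun _ => paretoMeasure 1 α) P) :
    ∀ᵐ y ∂(volume.restrict (Ioi (1 : ℝ))), ∀ x ∈ Ici y,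
      |cdf (condDistrib (fun ω => ∑ i, X ω i) (fun ω => pivot (X ω) (r + 1)) P y) x -
        normexInner (m + 1 + r) (r + 1) α y (x - y)| ≤ 2 * normalError hα m y := by
  filter_upwards [cdf_condDistrib_sum hα hX, ae_restrict_mem measurableSet_Ioi] with y hcdf hy x hx
  rw [hcdf]
  exact abs_conv_real_Iic_sub_normexInner_le hα hm hy hx

lemma abs_cdf_sub_normexCDF_le_integral_normalError (hα : 0 < α) (hm : 0 < m)
    (hX : HasLaw X (Measure.pi fun _ => paretoMeasure 1 α) P) {x : ℝ} (hx : 1 ≤ x) :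
    |cdf (P.map fun ω => ∑ i, X ω i) x - normexCDF (m + 1 + r) (r + 1) α x| ≤
      2 * ∫ y, normalError hα m y ∂(pivotLaw α m r) :=
  (abs_cdf_sub_normexCDF_le hα hm hX hx).trans
    (mul_le_mul_of_nonneg_left (intervalIntegral_normalError_le hα hx) two_pos.le)

end FixedSize

section Limits

variable {α : ℝ} {Ω : ℕ → Type*} [∀ n, MeasurableSpace (Ω n)] {P : ∀ n, Measure (Ω n)}
  [∀ n, IsProbabilityMeasure (P n)] {X : ∀ n, Ω n → Fin n → ℝ}

lemma map_add_one_add_atTop (r : ℕ) : map (fun m : ℕ => m + 1 + r) atTop = atTop := by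
  simpa only [add_assoc] using map_add_atTop_eq_nat (1 + r)

lemma tendstoUniformlyOn_zero_of_abs_le {β : Type*} (r : ℕ) {F : ℕ → β → ℝ} {g : ℕ → ℝ}
    {s : Set β} (hF : ∀ m, 0 < m → ∀ x ∈ s, |F (m + 1 + r) x| ≤ g m)
    (hg : Tendsto g atTop (𝓝 0)) : TendstoUniformlyOn F (fun _ => 0) atTop s := by
  refine Metric.tendstoUniformlyOn_iff.2 fun ε hε => ?_
  rw [← map_add_one_add_atTop r, eventually_map]
  filter_upwards [hg.eventually_lt_const hε, eventually_gt_atTop 0] with m hlt hm x hx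
  rw [dist_zero_left, Real.norm_eq_abs]
  exact (hF m hm x hx).trans_lt hlt

theorem tendsto_kolmogorovDist_condDistrib (hα : 0 < α) (r : ℕ)
    (hX : ∀ n, HasLaw (X n) (Measure.pi fun _ => paretoMeasure 1 α) (P n)) :
    ∀ᵐ y ∂(volume.restrict (Ioi (1 : ℝ))),
      Tendsto (fun n => kolmogorovDist
          (condDistrib (fun ω => trimmedSum (X n ω) (r + 1))
            (fun ω => pivot (X n ω) (r + 1)) (P n) y)
          (condNormal n (r + 1) α y)) atTop (𝓝 0) := by
  filter_upwards [ae_all_iff.2 fun m => kolmogorovDist_condDistrib_trimmedSum hα (hX (m + 1 + r)),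
    ae_restrict_mem measurableSet_Ioi] with y hdist hy
  rw [← map_add_one_add_atTop r, tendsto_map'_iff]
  exact (tendsto_normalError hα hy).congr fun m => (hdist m).symm

theorem tendstoUniformlyOn_cdf_condDistrib_sub_normexInner (hα : 0 < α) (r : ℕ)
    (hX : ∀ n, HasLaw (X n) (Measure.pi fun _ => paretoMeasure 1 α) (P n)) :
    ∀ᵐ y ∂(volume.restrict (Ioi (1 : ℝ))),
      TendstoUniformlyOn
        (fun n x => cdf (condDistrib (fun ω => ∑ i, X n ω i)
            (fun ω => pivot (X n ω) (r + 1)) (P n) y) x - normexInner n (r + 1) α y (x - y))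
        (fun _ => 0) atTop (Ici y) := by
  filter_upwards [ae_all_iff.2 fun m => ae_all_iff.2 fun hm : 0 < m =>
      abs_cdf_condDistrib_sum_sub_normexInner_le hα hm (hX (m + 1 + r)),
    ae_restrict_mem measurableSet_Ioi] with y hle hy
  refine tendstoUniformlyOn_zero_of_abs_le r hle ?_
  simpa only [mul_zero] using (tendsto_normalError hα hy).const_mul 2

theorem tendstoUniformlyOn_cdf_sub_normexCDF (hα₀ : 0 < α) (hα : 2 ≤ α) (r : ℕ)
    (hX : ∀ n, HasLaw (X n) (Measure.pi fun _ => paretoMeasure 1 α) (P n)) :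
    TendstoUniformlyOn
      (fun n x => cdf ((P n).map fun ω => ∑ i, X n ω i) x - normexCDF n (r + 1) α x)
      (fun _ => 0) atTop (Ici 1) := by
  refine tendstoUniformlyOn_zero_of_abs_le r (fun m hm x hx =>
    abs_cdf_sub_normexCDF_le_integral_normalError hα₀ hm (hX (m + 1 + r)) hx) ?_
  simpa only [mul_zero] using (tendsto_integral_normalError hα₀ hα r).const_mul 2

end Limits

end Normex

end

theorem theorem1_general {α : ℝ} (hα : 0 < α) {k : ℕ} (hk : 0 < k)
    {Ω : ℕ → Type*} [∀ n, MeasurableSpace (Ω n)]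
    (P : ∀ n, Measure (Ω n)) [∀ n, IsProbabilityMeasure (P n)]
    (X : ∀ n, Ω n → Fin n → ℝ)
    (hind : ∀ n, iIndepFun (fun (i : Fin n) (ω : Ω n) => X n ω i) (P n))
    (hlaw : ∀ (n : ℕ) (i : Fin n), HasLaw (fun ω => X n ω i) (paretoMeasure 1 α) (P n)) :
    (∀ n, k < n →
      (∀ ω, ∑ i, X n ω i =
        Normex.trimmedSum (X n ω) k + Normex.pivot (X n ω) k + Normex.topSum (X n ω) k) ∧
      (P n).map (fun ω => Normex.pivot (X n ω) k) =
        (volume.restrict (Ioi 1)).withDensity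
          (fun y => ENNReal.ofReal (Normex.orderStatPDF n (n - k + 1) α y)) ∧
      (∀ᵐ y ∂(volume.restrict (Ioi (1 : ℝ))),
        condDistrib (fun ω => (Normex.trimmedSum (X n ω) k, Normex.topSum (X n ω) k))
            (fun ω => Normex.pivot (X n ω) k) (P n) y =
          (condDistrib (fun ω => Normex.trimmedSum (X n ω) k)
            (fun ω => Normex.pivot (X n ω) k) (P n) y).prod
          (condDistrib (fun ω => Normex.topSum (X n ω) k)
            (fun ω => Normex.pivot (X n ω) k) (P n) y)) ∧
      (2 ≤ k → ∀ᵐ y ∂(volume.restrict (Ioi (1 : ℝ))),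
        condDistrib (fun ω => Normex.topSum (X n ω) k)
            (fun ω => Normex.pivot (X n ω) k) (P n) y =
          volume.withDensity
            (fun u => ENNReal.ofReal (Normex.convPow (Normex.upperPDF α y) (k - 1) u))) ∧
      (∀ᵐ y ∂(volume.restrict (Ioi (1 : ℝ))),
        MemLp id 2 (condDistrib (fun ω => Normex.trimmedSum (X n ω) k)
          (fun ω => Normex.pivot (X n ω) k) (P n) y) ∧
        ∫ t, t ∂(condDistrib (fun ω => Normex.trimmedSum (X n ω) k)
          (fun ω => Normex.pivot (X n ω) k) (P n) y) = Normex.condMean n k α y ∧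
        variance id (condDistrib (fun ω => Normex.trimmedSum (X n ω) k)
          (fun ω => Normex.pivot (X n ω) k) (P n) y) = Normex.condVar n k α y ∧
        0 < Normex.condVar n k α y) ∧
      (∀ x : ℝ, 1 ≤ x →
        |cdf ((P n).map (fun ω => ∑ i, X n ω i)) x - Normex.normexCDF n k α x| ≤
          2 * ∫ y in (1 : ℝ)..x, Normex.orderStatPDF n (n - k + 1) α y *
            Normex.kolmogorovDist
              (condDistrib (fun ω => Normex.trimmedSum (X n ω) k)
                (fun ω => Normex.pivot (X n ω) k) (P n) y)
              (Normex.condNormal n k α y))) ∧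
    (∀ᵐ y ∂(volume.restrict (Ioi (1 : ℝ))),
      Tendsto (fun n => Normex.kolmogorovDist
          (condDistrib (fun ω => Normex.trimmedSum (X n ω) k)
            (fun ω => Normex.pivot (X n ω) k) (P n) y)
          (Normex.condNormal n k α y)) atTop (𝓝 0)) ∧
    (∀ᵐ y ∂(volume.restrict (Ioi (1 : ℝ))),
      TendstoUniformlyOn
        (fun n x => cdf (condDistrib (fun ω => ∑ i, X n ω i)
            (fun ω => Normex.pivot (X n ω) k) (P n) y) x - Normex.normexInner n k α y (x - y))
        (fun _ => 0) atTop (Ici y)) ∧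
    (2 ≤ α →
      TendstoUniformlyOn
        (fun n x => cdf ((P n).map (fun ω => ∑ i, X n ω i)) x - Normex.normexCDF n k α x)
        (fun _ => 0) atTop (Ici 1)) := by
  obtain ⟨r, rfl⟩ := Nat.exists_eq_add_one.2 hk
  have hX (n : ℕ) : HasLaw (X n) (Measure.pi fun _ => paretoMeasure 1 α) (P n) :=
    (hind n).hasLaw_pi (hlaw n)
  refine ⟨fun n hn => ?_, Normex.tendsto_kolmogorovDist_condDistrib hα r hX,
    Normex.tendstoUniformlyOn_cdf_condDistrib_sub_normexInner hα r hX,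
    fun hα2 => Normex.tendstoUniformlyOn_cdf_sub_normexCDF hα hα2 r hX⟩
  obtain ⟨m, rfl⟩ : ∃ m, n = m + 1 + r := ⟨n - 1 - r, by lia⟩
  have hm : 0 < m := by lia
  rw [show m + 1 + r - (r + 1) + 1 = m + 1 by lia]
  exact ⟨fun ω => Normex.sum_eq_trimmedSum_add_pivot_add_topSum r.succ_pos hn.le _,
    Normex.map_pivot_sample hα (hX _),
    Normex.condDistrib_trimmedSum_topSum_eq_prod hα (hX _),
    fun hr => Normex.condDistrib_topSum_eq_withDensity hα (by lia) (hX _),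
    Normex.condDistrib_trimmedSum_moments hα hm (hX _),
    fun x hx => Normex.abs_cdf_sub_normexCDF_le_integral_kolmogorovDist hα hm (hX _) hx⟩

theorem theorem1 {α : ℝ} (hα : 0 < α) (hα4 : α ≤ 4) {k : ℕ} (hk : k = Normex.threshold α)
    {Ω : ℕ → Type*} [∀ n, MeasurableSpace (Ω n)]
    (P : ∀ n, Measure (Ω n)) [∀ n, IsProbabilityMeasure (P n)]
    (X : ∀ n, Ω n → Fin n → ℝ)
    (hind : ∀ n, iIndepFun (fun (i : Fin n) (ω : Ω n) => X n ω i) (P n))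
    (hlaw : ∀ (n : ℕ) (i : Fin n), HasLaw (fun ω => X n ω i) (paretoMeasure 1 α) (P n)) :
    -- for every sample size: the decomposition, the exact parts of the mixture, the conditional
    -- mean and variance of the trimmed sum, and the error bound
    (∀ n, k < n →
      (∀ ω, ∑ i, X n ω i =
        Normex.trimmedSum (X n ω) k + Normex.pivot (X n ω) k + Normex.topSum (X n ω) k) ∧
      (P n).map (fun ω => Normex.pivot (X n ω) k) =
        (volume.restrict (Ioi 1)).withDensity
          (fun y => ENNReal.ofReal (Normex.orderStatPDF n (n - k + 1) α y)) ∧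
      (∀ᵐ y ∂(volume.restrict (Ioi (1 : ℝ))),
        condDistrib (fun ω => (Normex.trimmedSum (X n ω) k, Normex.topSum (X n ω) k))
            (fun ω => Normex.pivot (X n ω) k) (P n) y =
          (condDistrib (fun ω => Normex.trimmedSum (X n ω) k)
            (fun ω => Normex.pivot (X n ω) k) (P n) y).prod
          (condDistrib (fun ω => Normex.topSum (X n ω) k)
            (fun ω => Normex.pivot (X n ω) k) (P n) y)) ∧
      (2 ≤ k → ∀ᵐ y ∂(volume.restrict (Ioi (1 : ℝ))),
        condDistrib (fun ω => Normex.topSum (X n ω) k)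
            (fun ω => Normex.pivot (X n ω) k) (P n) y =
          volume.withDensity
            (fun u => ENNReal.ofReal (Normex.convPow (Normex.upperPDF α y) (k - 1) u))) ∧
      (∀ᵐ y ∂(volume.restrict (Ioi (1 : ℝ))),
        MemLp id 2 (condDistrib (fun ω => Normex.trimmedSum (X n ω) k)
          (fun ω => Normex.pivot (X n ω) k) (P n) y) ∧
        ∫ t, t ∂(condDistrib (fun ω => Normex.trimmedSum (X n ω) k)
          (fun ω => Normex.pivot (X n ω) k) (P n) y) = Normex.condMean n k α y ∧
        variance id (condDistrib (fun ω => Normex.trimmedSum (X n ω) k)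
          (fun ω => Normex.pivot (X n ω) k) (P n) y) = Normex.condVar n k α y ∧
        0 < Normex.condVar n k α y) ∧
      (∀ x : ℝ, 1 ≤ x →
        |cdf ((P n).map (fun ω => ∑ i, X n ω i)) x - Normex.normexCDF n k α x| ≤
          2 * ∫ y in (1 : ℝ)..x, Normex.orderStatPDF n (n - k + 1) α y *
            Normex.kolmogorovDist
              (condDistrib (fun ω => Normex.trimmedSum (X n ω) k)
                (fun ω => Normex.pivot (X n ω) k) (P n) y)
              (Normex.condNormal n k α y))) ∧
    -- the normal approximation of the trimmed sum given the pivot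
    (∀ᵐ y ∂(volume.restrict (Ioi (1 : ℝ))),
      Tendsto (fun n => Normex.kolmogorovDist
          (condDistrib (fun ω => Normex.trimmedSum (X n ω) k)
            (fun ω => Normex.pivot (X n ω) k) (P n) y)
          (Normex.condNormal n k α y)) atTop (𝓝 0)) ∧
    -- the approximation of the whole sum given the pivot
    (∀ᵐ y ∂(volume.restrict (Ioi (1 : ℝ))),
      TendstoUniformlyOn
        (fun n x => cdf (condDistrib (fun ω => ∑ i, X n ω i)
            (fun ω => Normex.pivot (X n ω) k) (P n) y) x - Normex.normexInner n k α y (x - y))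
        (fun _ => 0) atTop (Ici y)) ∧
    -- the approximation of the cdf of the sum
    (2 ≤ α →
      TendstoUniformlyOn
        (fun n x => cdf ((P n).map (fun ω => ∑ i, X n ω i)) x - Normex.normexCDF n k α x)
        (fun _ => 0) atTop (Ici 1)) :=
  theorem1_general hα (hk ▸ Nat.succ_pos _) P X hind hlaw
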